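/- Fix a field $\mathbb F$ and $T=\{0,\dots,N\}$. Let $L_\bullet:\emptyset=L_0\subseteq\dots\subseteq L_N=L$ and $K_\bullet:\emptyset=K_0\subseteq\dots\subseteq K_N=K$ be filtrations of finite simplicial complexes, and let $f_\bullet\colon L_\bullet\to K_\bullet$ be a monomorphism of filtrations inducing an isomorphism $f\colon L\to K$. For a simplex $\sigma$ of $L$ (resp. $K$) let $l(\sigma)$ (resp. $k(\sigma)$) be the first index $t$ with $\sigma\in L_t$ (resp. $\sigma\in K_t$). Order the $n$ simplices of $L$ and the $n$ simplices of $K$ by arbitrary linear refinements of their orders of appearance in $L_\bullet$ and $K_\bullet$. Let $D^L$ be the matrix of the (non-augmented) simplicial boundary operator of $L$ over $\mathbb F$ with respect to the chosen order, $F$ the matrix of the chain isomorphism induced by $f$, and $D^f=D^LF^{-1}$, so that the rows of $D^f$ are indexed by the simplices of $L$ and its columns by those of $K$. For an $n\times n$ matrix $A$ let $A^\perp$ be its transpose along the anti-diagonal; thus the columns of $(D^L)^\perp$ and $(D^f)^\perp$ and the rows of $(D^L)^\perp$ are indexed by the simplices of $L$ in reverse order, and the rows of $(D^f)^\perp$ by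 the simplices of $K$ in reverse order. The degree of a column indexed by a simplex is the dimension of that simplex. The $j$-th column of a matrix $X$ is denoted $x_j$. The pivot of a nonzero column is the largest index of a nonzero entry, $\operatorname{pivs}X$ is the set of pivots of nonzero columns of $X$, and $\operatorname{pivsimp}c$ is the simplex corresponding to the pivot of $c$. A matrix is reduced if no two nonzero columns have the same pivot. A reduction of $D$ is an equation $R=DV$ with $R$ reduced and $V$ upper triangular of full rank. A left-to-right column operation scales a column by a nonzero factor or adds a multiple of a column to a later column. Then: (1) $(D^L)^\perp$ can be reduced with clearing: process the columns in increasing degree $d=0,1,2,\dots$; in degree $d$, first set to zero every column of degree $d$ whose index is the pivot of a nonzero (already reduced) column of degree $d-1$, and then apply left-to-right column operations among the remaining columns of degree $d$ until the nonzero columns of degree $d$ have pairwise distinct pivots. This is always possible, and every matrix that results after all degrees have been processed is of the form $(D^L)^\perp V$ for a reduction of $(D^L)^\perp$. (2) $(D^f)^\perp$ can be reduced with clearing: let $R=(D^L)^\perp V$ be any reduction, and set to zero all columns of $(D^f)^\perp$ with index $j$ such that $r_j=0$. The remaining columns can be brought by left-to-right column operations among them to a reduced matrix. No column other than the cleared ones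 becomes zero at any stage of such operations, and every reduced matrix so obtained is of the form $(D^f)^\perp W$ for a reduction of $(D^f)^\perp$. (3) For any reductions $S=(D^f)^\perp W$ and $R=(D^L)^\perp V$, the image $\operatorname{im}H_*(f_\bullet)$ of the morphism $H_*(f_\bullet)\colon H_*(L_\bullet)\to H_*(K_\bullet)$ of persistence modules indexed by $T$ (simplicial homology with coefficients in $\mathbb F$) has the barcode given by the multiset \[ \{[l(\operatorname{pivsimp}w_j),k(\operatorname{pivsimp}s_j))\neq\emptyset\mid s_j\neq0\}\cup\{[l(\operatorname{pivsimp}v_i),\infty)\mid r_i=0\text{ and }i\notin\operatorname{pivs}R\}, \] where intervals are understood as subsets of $T$ and $\cup$ is the union of multisets, that is, $\operatorname{im}H_*(f_\bullet)$ is isomorphic to the direct sum of the corresponding interval modules. Moreover, for every $d\ge0$, $\operatorname{im}H_d(f_\bullet)$ has the barcode consisting of those of these intervals for which $\operatorname{pivsimp}w_j$, respectively $\operatorname{pivsimp}v_i$, has dimension $d$. -/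

import Mathlib

open CategoryTheory

universe u v w

/-! ### Persistence modules indexed by `{0, …, N}` and barcodes -/

/-- Persistence modules over `𝔽` indexed by `T = {0, …, N}`. -/
abbrev PersMod (𝔽 : Type v) [Field 𝔽] (N : ℕ) := Fin (N + 1) ⥤ ModuleCat.{w} 𝔽

/-- Intervals (order-convex subsets) of `T = {0, …, N}`. -/
abbrev TInterval (N : ℕ) := {I : Set (Fin (N + 1)) // I.OrdConnected}

/-- The half-open interval `[a, b)`. -/
def TInterval.ico {N : ℕ} (a b : Fin (N + 1)) : TInterval N := ⟨Set.Ico a b, Set.ordConnected_Ico⟩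

/-- The interval `[a, ∞)`. -/
def TInterval.ici {N : ℕ} (a : Fin (N + 1)) : TInterval N := ⟨Set.Ici a, Set.ordConnected_Ici⟩

open Classical in
/-- The value at `t` of the interval module of `I`: it is `𝔽` if `t ∈ I`, and `0` otherwise. -/
noncomputable def intervalValue (𝔽 : Type v) [Field 𝔽] {N : ℕ} (I : TInterval N)
    (t : Fin (N + 1)) : Submodule 𝔽 𝔽 := if t ∈ I.1 then ⊤ else ⊥

open Classical in
/-- The structure map of the interval module: the identity of `𝔽` if both indices lie in `I`,
and `0` otherwise. -/
noncomputable def intervalMap (𝔽 : Type v) [Field 𝔽] {N : ℕ} (I : TInterval N)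
    (t t' : Fin (N + 1)) : intervalValue 𝔽 I t →ₗ[𝔽] intervalValue 𝔽 I t' :=
  if h : t ∈ I.1 ∧ t' ∈ I.1 then
    Submodule.inclusion (by simp [intervalValue, h.1, h.2])
  else 0

/-- The interval module `C(I)`. -/
noncomputable def intervalModule (𝔽 : Type v) [Field 𝔽] {N : ℕ} (I : TInterval N) :
    PersMod.{v, v} 𝔽 N where
  obj t := ModuleCat.of 𝔽 (intervalValue 𝔽 I t)
  map {t t'} _ := ModuleCat.ofHom (intervalMap 𝔽 I t t')
  map_id t := by
    ext x
    by_cases h : t ∈ I.1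
    · simp [intervalMap, h]
    · have hx : (x : 𝔽) = 0 := by
        have hx := x.2
        simp only [intervalValue, h, if_false, Submodule.mem_bot] at hx
        exact hx
      simp [intervalMap, h, hx]
  map_comp {a b c} f g := by
    ext x
    by_cases ha : a ∈ I.1
    · by_cases hc : c ∈ I.1
      · have hb : b ∈ I.1 := I.2.out ha hc ⟨leOfHom f, leOfHom g⟩
        simp [intervalMap, ha, hb, hc]
      · simp [intervalMap, hc]
    · simp [intervalMap, ha]

/-- Pointwise direct sum of a family of persistence modules. -/
noncomputable def PersMod.directSum {𝔽 : Type v} [Field 𝔽] {N : ℕ} {A : Type}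
    (M : A → PersMod.{v, w} 𝔽 N) : PersMod.{v, w} 𝔽 N where
  obj t := ModuleCat.of 𝔽 (DirectSum A fun a => (M a).obj t)
  map g := ModuleCat.ofHom (DirectSum.lmap fun a => ((M a).map g).hom)
  map_id t := by
    refine ModuleCat.hom_ext (LinearMap.ext fun x => DFinsupp.ext fun a => ?_)
    simp
  map_comp f g := by
    refine ModuleCat.hom_ext (LinearMap.ext fun x => DFinsupp.ext fun a => ?_)
    simp [DirectSum.lmap_apply]

/-- Direct sum of a family of morphisms of persistence modules. -/
noncomputable def PersMod.directSumMap {𝔽 : Type v} [Field 𝔽] {N : ℕ} {A : Type}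
    {M M' : A → PersMod.{v, w} 𝔽 N} (η : ∀ a, M a ⟶ M' a) :
    PersMod.directSum M ⟶ PersMod.directSum M' where
  app t := ModuleCat.ofHom (DirectSum.lmap fun a => ((η a).app t).hom)
  naturality s t g := by
    refine ModuleCat.hom_ext (LinearMap.ext fun (x : DirectSum A fun a => (M a).obj s) =>
      DFinsupp.ext fun a => ?_)
    exact congrArg (fun k => k.hom (x a)) ((η a).naturality g)

/-- The (pointwise) image of a morphism of persistence modules. -/
noncomputable def PersMod.image {𝔽 : Type v} [Field 𝔽] {N : ℕ} {M M' : PersMod.{v, w} 𝔽 N}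
    (η : M ⟶ M') : PersMod.{v, w} 𝔽 N where
  obj t := ModuleCat.of 𝔽 (LinearMap.range (η.app t).hom)
  map {s t} g := ModuleCat.ofHom ((M'.map g).hom.restrict (by
    rintro _ ⟨x, rfl⟩
    refine ⟨(M.map g).hom x, ?_⟩
    exact congrArg (fun k => k.hom x) (η.naturality g)))
  map_id t := by
    ext x
    simp
  map_comp f g := by
    ext x
    simp

/-- `M` has a barcode given by the family of intervals `(I a)`: it is isomorphic (through linear
isomorphisms commuting with the structure maps) to the direct sum of the interval modules
`C(I a)`. -/
def PersMod.HasBarcode {𝔽 : Type v} [Field 𝔽] {N : ℕ} (M : PersMod.{v, w} 𝔽 N) {A : Type}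
    (I : A → TInterval N) : Prop :=
  ∃ e : ∀ t, M.obj t ≃ₗ[𝔽] (PersMod.directSum fun a => intervalModule 𝔽 (I a)).obj t,
    ∀ (s t : Fin (N + 1)) (g : s ⟶ t) (x : M.obj s),
      e t ((M.map g).hom x) =
        ((PersMod.directSum fun a => intervalModule 𝔽 (I a)).map g).hom (e s x)

/-! ### Simplicial chains

Simplices are nonempty finite sets of vertices, oriented by a linear order of the vertices. The
chain groups of all complexes with vertices in `V` are subspaces of `Finset V →₀ 𝔽`. -/

/-- The simplicial boundary operator. The boundary of a vertex is `0`. -/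
noncomputable def simplicialBoundary (𝔽 : Type v) [Field 𝔽] (V : Type u) [LinearOrder V] :
    (Finset V →₀ 𝔽) →ₗ[𝔽] (Finset V →₀ 𝔽) :=
  Finsupp.linearCombination 𝔽 fun s : Finset V =>
    if 2 ≤ s.card then
      ∑ x ∈ s, Finsupp.single (s.erase x) ((-1 : 𝔽) ^ (s.filter (· < x)).card)
    else 0

/-- The number of pairs of vertices of `s` whose order is reversed by `f`. -/
def inversions {U V : Type u} [LinearOrder U] [LinearOrder V] (f : U → V) (s : Finset U) : ℕ :=
  ((s ×ˢ s).filter fun p => p.1 < p.2 ∧ f p.2 < f p.1).card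

/-- The map on chains induced by a vertex map `f` that is injective on the simplices under
consideration: the simplex `s` is sent to `f(s)`, with the sign that compares the orientation
of `f(s)` with the image of the orientation of `s`. -/
noncomputable def chainMap (𝔽 : Type v) [Field 𝔽] {U V : Type u} [LinearOrder U] [LinearOrder V]
    (f : U → V) : (Finset U →₀ 𝔽) →ₗ[𝔽] (Finset V →₀ 𝔽) :=
  Finsupp.linearCombination 𝔽 fun s : Finset U =>
    Finsupp.single (s.image f) ((-1 : 𝔽) ^ inversions f s)

theorem inversions_erase {U V : Type u} [LinearOrder U] [LinearOrder V] (f : U → V)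
    (s : Finset U) (x : U) (hx : x ∈ s) :
    inversions f s = inversions f (s.erase x) +
      ((s.erase x).filter fun y => (y < x ∧ f x < f y) ∨ (x < y ∧ f y < f x)).card := by
  unfold inversions
  have hinj : Function.Injective fun y : U => if y < x then (y, x) else (x, y) := by
    intro y z h
    by_cases hy : y < x <;> by_cases hz : z < x <;> simp_all
  rw [← Finset.card_image_of_injective _ hinj, ← Finset.card_union_of_disjoint]
  · congr 1
    ext ⟨a, b⟩
    simp only [Finset.mem_filter, Finset.mem_product, Finset.mem_union, Finset.mem_image,
      Finset.mem_erase]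
    constructor
    · rintro ⟨⟨ha, hb⟩, hab, hf⟩
      by_cases hax : a = x
      · subst hax
        exact Or.inr ⟨b, ⟨⟨hab.ne', hb⟩, Or.inr ⟨hab, hf⟩⟩, by simp [hab.not_gt]⟩
      · by_cases hbx : b = x
        · subst hbx
          exact Or.inr ⟨a, ⟨⟨hax, ha⟩, Or.inl ⟨hab, hf⟩⟩, by simp [hab]⟩
        · exact Or.inl ⟨⟨⟨hax, ha⟩, hbx, hb⟩, hab, hf⟩
    · rintro (⟨⟨⟨_, ha⟩, _, hb⟩, hab, hf⟩ | ⟨y, ⟨⟨hyx, hy⟩, h⟩, he⟩)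
      · exact ⟨⟨ha, hb⟩, hab, hf⟩
      · rcases h with ⟨h1, h2⟩ | ⟨h1, h2⟩
        · simp only [h1, if_true, Prod.mk.injEq] at he
          obtain ⟨rfl, rfl⟩ := he
          exact ⟨⟨hy, hx⟩, h1, h2⟩
        · simp only [h1.not_gt, if_false, Prod.mk.injEq] at he
          obtain ⟨rfl, rfl⟩ := he
          exact ⟨⟨hx, hy⟩, h1, h2⟩
  · rw [Finset.disjoint_left]
    rintro ⟨a, b⟩ h1 h2
    simp only [Finset.mem_filter, Finset.mem_product, Finset.mem_image, Finset.mem_erase] at h1 h2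
    obtain ⟨y, -, he⟩ := h2
    split_ifs at he <;> simp_all

theorem sign_erase (𝔽 : Type v) [Field 𝔽] {U V : Type u} [LinearOrder U] [LinearOrder V]
    (f : U → V) (s : Finset U) (hf : Set.InjOn f s) (x : U) (hx : x ∈ s) :
    (-1 : 𝔽) ^ inversions f s * (-1 : 𝔽) ^ ((s.image f).filter (· < f x)).card =
      (-1 : 𝔽) ^ (s.filter (· < x)).card * (-1 : 𝔽) ^ inversions f (s.erase x) := by
  have h1 : ((s.image f).filter (· < f x)).card =
      ((s.erase x).filter fun y => f y < f x).card := by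
    rw [Finset.filter_image, Finset.card_image_of_injOn]
    · congr 1
      ext y
      simp only [Finset.mem_filter, Finset.mem_erase]
      exact ⟨fun h => ⟨⟨fun e => by simp [e] at h, h.1⟩, h.2⟩, fun h => ⟨h.1.2, h.2⟩⟩
    · exact hf.mono (by intro y hy; simp at hy; exact hy.1)
  have h2 : (s.filter (· < x)).card = ((s.erase x).filter (· < x)).card := by
    congr 1
    ext y
    simp only [Finset.mem_filter, Finset.mem_erase]
    exact ⟨fun h => ⟨⟨h.2.ne, h.1⟩, h.2⟩, fun h => ⟨h.1.2, h.2⟩⟩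
  have h3 : ((s.erase x).filter fun y => (y < x ∧ f x < f y) ∨ (x < y ∧ f y < f x)).card +
      ((s.erase x).filter fun y => f y < f x).card =
      ((s.erase x).filter (· < x)).card +
        2 * ((s.erase x).filter fun y => x < y ∧ f y < f x).card := by
    simp only [Finset.card_filter, Finset.mul_sum, ← Finset.sum_add_distrib]
    refine Finset.sum_congr rfl fun y hy => ?_
    rw [Finset.mem_erase] at hy
    have hne : f y ≠ f x := fun e => hy.1 (hf hy.2 hx e)
    rcases lt_or_gt_of_ne hy.1 with h | h <;> rcases lt_or_gt_of_ne hne with h' | h' <;>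
      simp [h, h', h.not_gt, h'.not_gt]
  rw [inversions_erase f s x hx, h1, h2, ← pow_add, add_assoc, h3, pow_add, pow_add, pow_mul]
  simp [mul_comm]

theorem chainMap_boundary_single (𝔽 : Type v) [Field 𝔽] {U V : Type u} [LinearOrder U]
    [LinearOrder V] (f : U → V) (s : Finset U) (hf : Set.InjOn f s) :
    simplicialBoundary 𝔽 V (chainMap 𝔽 f (Finsupp.single s 1)) =
      chainMap 𝔽 f (simplicialBoundary 𝔽 U (Finsupp.single s 1)) := by
  simp only [chainMap, simplicialBoundary, Finsupp.linearCombination_single, one_smul,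
    Finset.card_image_of_injOn hf]
  split_ifs with h
  · rw [map_sum, Finset.sum_image hf, Finset.smul_sum]
    refine Finset.sum_congr rfl fun x hx => ?_
    rw [Finsupp.linearCombination_single, Finsupp.smul_single, Finsupp.smul_single, smul_eq_mul,
      smul_eq_mul, sign_erase 𝔽 f s hf x hx]
    congr 1
    ext y
    simp only [Finset.mem_erase, Finset.mem_image]
    constructor
    · rintro ⟨hy, z, hz, rfl⟩
      exact ⟨z, ⟨fun e => hy (by rw [e]), hz⟩, rfl⟩
    · rintro ⟨z, ⟨hzx, hz⟩, rfl⟩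
      exact ⟨fun e => hzx (hf hz hx e), z, hz, rfl⟩
  · simp

/-! ### Filtrations of simplicial complexes and their homology -/

/-- A filtration `∅ = K₀ ⊆ K₁ ⊆ ⋯ ⊆ K_N = K` of finite simplicial complexes. -/
structure SimplicialFiltration (V : Type u) (N : ℕ) where
  complex : Fin (N + 1) → PreAbstractSimplicialComplex V
  mono : Monotone complex
  start : complex 0 = ⊥
  finite : (complex (Fin.last N)).faces.Finite

namespace SimplicialFiltration

variable {V : Type u} {N : ℕ}

/-- The simplices of the final complex `K = K_N`. -/
abbrev Simplex (F : SimplicialFiltration V N) := {s : Finset V // s ∈ F.complex (Fin.last N)}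

/-- The function on the simplices of `K` whose sublevel sets are the complexes `K_t`: the first
index at which a simplex is present. -/
noncomputable def entry (F : SimplicialFiltration V N) (s : F.Simplex) : Fin (N + 1) :=
  sInf {t | s.1 ∈ F.complex t}

/-- The space of `d`-chains of `K_t`. -/
noncomputable def chains (𝔽 : Type v) [Field 𝔽] (F : SimplicialFiltration V N) (d : ℕ)
    (t : Fin (N + 1)) : Submodule 𝔽 (Finset V →₀ 𝔽) :=
  Finsupp.supported 𝔽 𝔽 {s | s ∈ F.complex t ∧ s.card = d + 1}

/-- The space of `d`-cycles of `K_t`. -/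
noncomputable def cycles [LinearOrder V] (𝔽 : Type v) [Field 𝔽] (F : SimplicialFiltration V N)
    (d : ℕ) (t : Fin (N + 1)) : Submodule 𝔽 (Finset V →₀ 𝔽) :=
  F.chains 𝔽 d t ⊓ LinearMap.ker (simplicialBoundary 𝔽 V)

/-- The space of `d`-boundaries of `K_t`. -/
noncomputable def boundaries [LinearOrder V] (𝔽 : Type v) [Field 𝔽]
    (F : SimplicialFiltration V N) (d : ℕ) (t : Fin (N + 1)) : Submodule 𝔽 (Finset V →₀ 𝔽) :=
  (F.chains 𝔽 (d + 1) t).map (simplicialBoundary 𝔽 V)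

theorem chains_mono (𝔽 : Type v) [Field 𝔽] (F : SimplicialFiltration V N) (d : ℕ)
    {s t : Fin (N + 1)} (h : s ≤ t) : F.chains 𝔽 d s ≤ F.chains 𝔽 d t :=
  Finsupp.supported_mono fun _ hx => ⟨F.mono h hx.1, hx.2⟩

end SimplicialFiltration

/-- The quotient `Z / (Z ∩ B)`. -/
abbrev Subquotient {𝔽 : Type v} [Field 𝔽] {X : Type w} [AddCommGroup X] [Module 𝔽 X]
    (Z B : Submodule 𝔽 X) := Z ⧸ B.submoduleOf Z

/-- The map `Z / (Z ∩ B) → Z' / (Z' ∩ B')` induced by a linear map `g` with `g(Z) ⊆ Z'` and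
`g(B) ⊆ B'`. -/
noncomputable def subquotientMap {𝔽 : Type v} [Field 𝔽] {X Y : Type w} [AddCommGroup X]
    [AddCommGroup Y] [Module 𝔽 X] [Module 𝔽 Y] {Z B : Submodule 𝔽 X} {Z' B' : Submodule 𝔽 Y}
    (g : X →ₗ[𝔽] Y) (hZ : ∀ x ∈ Z, g x ∈ Z') (hB : ∀ x ∈ B, g x ∈ B') :
    Subquotient Z B →ₗ[𝔽] Subquotient Z' B' :=
  Submodule.mapQ _ _ (g.restrict hZ) fun x hx => hB x.1 hx

/-- The persistent homology `H_d(K_•)`, where `H_d(K_t)` is the space of `d`-cycles modulo the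
space of `d`-boundaries of `K_t` and the structure maps are induced by the inclusions. -/
noncomputable def SimplicialFiltration.homology {V : Type u} [LinearOrder V] {N : ℕ}
    (𝔽 : Type v) [Field 𝔽] (F : SimplicialFiltration V N) (d : ℕ) :
    PersMod.{v, max u v} 𝔽 N where
  obj t := ModuleCat.of 𝔽 (Subquotient (F.cycles 𝔽 d t) (F.boundaries 𝔽 d t))
  map {s t} g := ModuleCat.ofHom (subquotientMap LinearMap.id
    (fun _ hx => ⟨F.chains_mono 𝔽 d (leOfHom g) hx.1, hx.2⟩)
    (Submodule.map_mono (F.chains_mono 𝔽 (d + 1) (leOfHom g))))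
  map_id t := by
    ext : 1
    apply Submodule.linearMap_qext
    ext x : 1
    rfl
  map_comp f g := by
    ext : 1
    apply Submodule.linearMap_qext
    ext x : 1
    rfl

/-- A monomorphism `f_• : L_• → K_•` of filtrations of simplicial complexes, given by a vertex map,
that induces an isomorphism `f : L → K` of the final complexes. -/
structure FiltrationMono {U V : Type u} [DecidableEq V] {N : ℕ} (L : SimplicialFiltration U N)
    (K : SimplicialFiltration V N) where
  toFun : U → V
  map_le : ∀ t, (L.complex t).map toFun ≤ K.complex t
  injOn : Set.InjOn toFun {x | {x} ∈ L.complex (Fin.last N)}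
  map_last : (L.complex (Fin.last N)).map toFun = K.complex (Fin.last N)

namespace FiltrationMono

theorem injOn_face {U V : Type u} [LinearOrder V] {N : ℕ} {L : SimplicialFiltration U N}
    {K : SimplicialFiltration V N} (f : FiltrationMono L K) {t : Fin (N + 1)} {s : Finset U}
    (hs : s ∈ L.complex t) : Set.InjOn f.toFun s := by
  refine f.injOn.mono fun x hx => ?_
  have h1 : s ∈ L.complex (Fin.last N) := L.mono (Fin.le_last t) hs
  exact ((L.complex (Fin.last N)).isRelLowerSet_faces h1).2
    (Finset.singleton_subset_iff.2 hx) (Finset.singleton_nonempty x)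

variable {U V : Type u} [LinearOrder U] [LinearOrder V] {N : ℕ} {L : SimplicialFiltration U N}
  {K : SimplicialFiltration V N}

theorem chainMap_mem (f : FiltrationMono L K) (𝔽 : Type v) [Field 𝔽] (d : ℕ) (t : Fin (N + 1))
    (c : Finset U →₀ 𝔽) (hc : c ∈ L.chains 𝔽 d t) :
    chainMap 𝔽 f.toFun c ∈ K.chains 𝔽 d t := by
  rw [chainMap, Finsupp.linearCombination_apply]
  refine Submodule.sum_mem _ fun s hs => Submodule.smul_mem _ _ ?_
  obtain ⟨h1, h2⟩ := (Finsupp.mem_supported 𝔽 c).1 hc hs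
  refine Finsupp.single_mem_supported 𝔽 _ ⟨?_, ?_⟩
  · exact f.map_le t (Set.mem_image_of_mem _ h1)
  · rw [Finset.card_image_of_injOn (f.injOn_face h1), h2]

theorem chainMap_boundary (f : FiltrationMono L K) (𝔽 : Type v) [Field 𝔽] (d : ℕ)
    (t : Fin (N + 1)) (c : Finset U →₀ 𝔽) (hc : c ∈ L.chains 𝔽 d t) :
    simplicialBoundary 𝔽 V (chainMap 𝔽 f.toFun c) =
      chainMap 𝔽 f.toFun (simplicialBoundary 𝔽 U c) := by
  have h : c = c.sum fun s a => a • Finsupp.single s (1 : 𝔽) := by simp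
  rw [h, Finsupp.sum]
  simp only [map_sum, map_smul]
  refine Finset.sum_congr rfl fun s hs => ?_
  rw [chainMap_boundary_single 𝔽 f.toFun s
    (f.injOn_face ((Finsupp.mem_supported 𝔽 c).1 hc hs).1)]

/-- The induced morphism `H_d(f_•) : H_d(L_•) ⟶ H_d(K_•)`. -/
noncomputable def homologyMap (f : FiltrationMono L K) (𝔽 : Type v) [Field 𝔽] (d : ℕ) :
    L.homology 𝔽 d ⟶ K.homology 𝔽 d where
  app t := ModuleCat.ofHom (subquotientMap (chainMap 𝔽 f.toFun)
    (fun x hx => ⟨f.chainMap_mem 𝔽 d t x hx.1, by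
      have h : simplicialBoundary 𝔽 U x = 0 := hx.2
      change simplicialBoundary 𝔽 V (chainMap 𝔽 f.toFun x) = 0
      rw [f.chainMap_boundary 𝔽 d t x hx.1, h, map_zero]⟩)
    (by
      rintro _ ⟨c, hc, rfl⟩
      exact ⟨chainMap 𝔽 f.toFun c, f.chainMap_mem 𝔽 (d + 1) t c hc,
        f.chainMap_boundary 𝔽 (d + 1) t c hc⟩))
  naturality s t g := by
    ext : 1
    apply Submodule.linearMap_qext
    ext x : 1
    rfl

/-- The induced morphism `H_*(f_•) : H_*(L_•) ⟶ H_*(K_•)`, where `H_*` is the direct sum of the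
`H_d`. -/
noncomputable def totalHomologyMap (f : FiltrationMono L K) (𝔽 : Type v) [Field 𝔽] :
    PersMod.directSum (L.homology 𝔽) ⟶ PersMod.directSum (K.homology 𝔽) :=
  PersMod.directSumMap (f.homologyMap 𝔽)

end FiltrationMono

/-! ### Matrices and their reduction -/

section Reduction

variable {𝔽 : Type v} [Field 𝔽] {n : ℕ}

open Classical in
/-- The pivot of a nonzero column vector: the largest index of a nonzero entry. -/
noncomputable def piv (c : Fin n → 𝔽) (hc : c ≠ 0) : Fin n :=
  (Finset.univ.filter fun i => c i ≠ 0).max' (by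
    obtain ⟨i, hi⟩ := Function.ne_iff.1 hc
    exact ⟨i, by simpa using hi⟩)

/-- The set of all pivots of nonzero columns. -/
def pivs (X : Matrix (Fin n) (Fin n) 𝔽) : Set (Fin n) :=
  {i | ∃ (j : Fin n) (hj : X.col j ≠ 0), piv (X.col j) hj = i}

/-- The nonzero columns of `X` with index in `s` have pairwise distinct pivots. -/
def IsColReducedOn (s : Set (Fin n)) (X : Matrix (Fin n) (Fin n) 𝔽) : Prop :=
  ∀ i ∈ s, ∀ j ∈ s, ∀ (hi : X.col i ≠ 0) (hj : X.col j ≠ 0),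
    piv (X.col i) hi = piv (X.col j) hj → i = j

/-- A matrix is reduced if no two nonzero columns have the same pivot. -/
def IsColReduced (X : Matrix (Fin n) (Fin n) 𝔽) : Prop := IsColReducedOn Set.univ X

/-- A reduction `R = D * V` of `D`, where `R` is reduced and `V` is upper triangular of full
rank. -/
structure Reduction (D : Matrix (Fin n) (Fin n) 𝔽) where
  R : Matrix (Fin n) (Fin n) 𝔽
  V : Matrix (Fin n) (Fin n) 𝔽
  eq_mul : R = D * V
  upper : ∀ i j, j < i → V i j = 0
  full_rank : V.rank = n
  reduced : IsColReduced R

theorem Reduction.V_col_ne_zero {D : Matrix (Fin n) (Fin n) 𝔽} (ρ : Reduction D) (j : Fin n) :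
    ρ.V.col j ≠ 0 := by
  intro h
  have hli : LinearIndependent 𝔽 ρ.V.col := by
    rw [linearIndependent_iff_card_eq_finrank_span, Set.finrank, ← Matrix.rank_eq_finrank_span_cols,
      ρ.full_rank, Fintype.card_fin]
  exact hli.ne_zero j h

/-- The transpose along the anti-diagonal. -/
def antiTranspose (X : Matrix (Fin n) (Fin n) 𝔽) : Matrix (Fin n) (Fin n) 𝔽 :=
  Matrix.of fun i j => X j.rev i.rev

/-- An elementary left-to-right column operation involving only columns with index in `s`:
scaling a column by a nonzero factor, or adding a multiple of a column to a later one. -/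
inductive ColumnOp (s : Set (Fin n)) :
    Matrix (Fin n) (Fin n) 𝔽 → Matrix (Fin n) (Fin n) 𝔽 → Prop
  | scale (X : Matrix (Fin n) (Fin n) 𝔽) (j : Fin n) (a : 𝔽) (hj : j ∈ s) (ha : a ≠ 0) :
      ColumnOp s X (X.updateCol j (a • X.col j))
  | add (X : Matrix (Fin n) (Fin n) 𝔽) (i j : Fin n) (a : 𝔽) (hi : i ∈ s) (hj : j ∈ s)
      (hij : i < j) : ColumnOp s X (X.updateCol j (X.col j + a • X.col i))

/-- `Y` arises from `X` by finitely many left-to-right column operations on columns in `s`. -/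
def ColumnOps (s : Set (Fin n)) (X Y : Matrix (Fin n) (Fin n) 𝔽) : Prop :=
  Relation.ReflTransGen (ColumnOp s) X Y

open Classical in
/-- Set the columns with index in `Z` to zero. -/
noncomputable def clearColumns (Z : Set (Fin n)) (X : Matrix (Fin n) (Fin n) 𝔽) :
    Matrix (Fin n) (Fin n) 𝔽 :=
  Matrix.of fun i j => if j ∈ Z then 0 else X i j

/-- The columns of degree `d` that are cleared before degree `d` is processed: those whose index
is a pivot of a nonzero column of degree `d - 1` (which has already been reduced). -/
def clearedIn (deg : Fin n → ℕ) (d : ℕ) (X : Matrix (Fin n) (Fin n) 𝔽) : Set (Fin n) :=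
  {j | deg j = d ∧ ∃ (i : Fin n) (hi : X.col i ≠ 0), deg i + 1 = d ∧ piv (X.col i) hi = j}

/-- `ClearingRun deg D d X`: the matrix `X` can occur in the reduction of `D` with clearing, in
increasing order of degrees, after the columns of all degrees less than `d` have been processed.
In degree `d`, first the columns whose indices are pivots of the already reduced columns of degree
`d - 1` are set to zero, and then the remaining columns of degree `d` are reduced by left-to-right
column operations among them. -/
inductive ClearingRun (deg : Fin n → ℕ) (D : Matrix (Fin n) (Fin n) 𝔽) :
    ℕ → Matrix (Fin n) (Fin n) 𝔽 → Prop
  | start : ClearingRun deg D 0 D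
  | step (d : ℕ) (X Y : Matrix (Fin n) (Fin n) 𝔽) (hX : ClearingRun deg D d X)
      (hops : ColumnOps {j | deg j = d ∧ j ∉ clearedIn deg d X}
        (clearColumns (clearedIn deg d X) X) Y)
      (hred : IsColReducedOn {j | deg j = d} Y) : ClearingRun deg D (d + 1) Y

end Reduction

/-! ### The matrices of a monomorphism of filtrations -/

/-- An enumeration of the simplices of `K` that is a linear refinement of the order in which they
appear in the filtration. -/
structure SimplexOrder {V : Type u} {N : ℕ} (F : SimplicialFiltration V N) (n : ℕ) where
  simplex : Fin n ≃ F.Simplex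
  refines : ∀ i j, i ≤ j → F.entry (simplex i) ≤ F.entry (simplex j)

namespace SimplexOrder

variable {V : Type u} {N n : ℕ} {F : SimplicialFiltration V N}

/-- The simplex corresponding to an index in the reverse order. -/
def revSimplex (e : SimplexOrder F n) (i : Fin n) : F.Simplex := e.simplex i.rev

/-- The dimension of the simplex corresponding to an index in the reverse order. -/
def revDim (e : SimplexOrder F n) (i : Fin n) : ℕ := (e.revSimplex i).1.card - 1

/-- The pivot simplex of a nonzero column vector whose entries are indexed by the simplices in
reverse order. -/
noncomputable def pivSimp {𝔽 : Type v} [Field 𝔽] (e : SimplexOrder F n) (c : Fin n → 𝔽)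
    (hc : c ≠ 0) : F.Simplex := e.revSimplex (piv c hc)

/-- The filtration boundary matrix. -/
noncomputable def boundaryMatrix (𝔽 : Type v) [Field 𝔽] [LinearOrder V] (e : SimplexOrder F n) :
    Matrix (Fin n) (Fin n) 𝔽 :=
  Matrix.of fun i j =>
    simplicialBoundary 𝔽 V (Finsupp.single (e.simplex j).1 1) (e.simplex i).1

end SimplexOrder

section ImageBarcode

variable {U V : Type u} [LinearOrder U] [LinearOrder V] {N n : ℕ}
  {L : SimplicialFiltration U N} {K : SimplicialFiltration V N}

/-- The matrix `F` of the chain map induced by `f` with respect to the simplices of `L` and `K`. -/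
noncomputable def FiltrationMono.chainMatrix (𝔽 : Type v) [Field 𝔽] (f : FiltrationMono L K)
    (eL : SimplexOrder L n) (eK : SimplexOrder K n) : Matrix (Fin n) (Fin n) 𝔽 :=
  Matrix.of fun i j =>
    chainMap 𝔽 f.toFun (Finsupp.single (eL.simplex j).1 1) (eK.simplex i).1

/-- The mixed boundary matrix `D^f = D^L * F⁻¹`, with columns indexed by the simplices of `K` and
rows indexed by the simplices of `L`. -/
noncomputable def FiltrationMono.mixedMatrix (𝔽 : Type v) [Field 𝔽] (f : FiltrationMono L K)
    (eL : SimplexOrder L n) (eK : SimplexOrder K n) : Matrix (Fin n) (Fin n) 𝔽 :=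
  eL.boundaryMatrix 𝔽 * (f.chainMatrix 𝔽 eL eK)⁻¹

variable {𝔽 : Type v} [Field 𝔽]

/-- The interval `[l(pivsimp w_j), k(pivsimp s_j))` for a nonzero column `s_j`, where `S = D * W`. -/
noncomputable def finiteBar (eL : SimplexOrder L n) (eK : SimplexOrder K n)
    {D : Matrix (Fin n) (Fin n) 𝔽} (S : Reduction D) (j : {j : Fin n // S.R.col j ≠ 0}) :
    TInterval N :=
  TInterval.ico (L.entry (eL.pivSimp (S.V.col j.1) (S.V_col_ne_zero j.1)))
    (K.entry (eK.pivSimp (S.R.col j.1) j.2))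

/-- The interval `[l(pivsimp v_i), ∞)`, where `R = D * V`. -/
noncomputable def infiniteBar (eL : SimplexOrder L n) {D : Matrix (Fin n) (Fin n) 𝔽}
    (R : Reduction D) (i : Fin n) : TInterval N :=
  TInterval.ici (L.entry (eL.pivSimp (R.V.col i) (R.V_col_ne_zero i)))

end ImageBarcode

/-! ### Pivots and reductions -/

section Pivots

open scoped Matrix

variable {𝔽 : Type v} [Field 𝔽] {n : ℕ}

/-! Let vectors be indexed by simplices in reverse order, so that the smallest index of a nonzero
entry, the leading index, is the latest simplex of a chain. The transpose of `(D^L)^⊥` is then the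
boundary operator of `L`, and the transpose of `(D^f)^⊥` sends a chain `y` of `K` to the chain
`f⁻¹(∂y)` of `L`. A reduction `R = DV` transposes to `Rᵀ = VᵀDᵀ`, where `Vᵀ` is lower triangular and
invertible and so preserves leading indices.

Reducedness now gives two facts. The indices outside `pivs R` are exactly the leading indices of
vectors in `ker Dᵀ` (`exists_ker_of_notMem_pivs`, `notMem_pivs_of_ker`). If `r_j ≠ 0` has pivot `p`,
then some vector supported on indices `≥ p` has an image under `Dᵀ` with leading index `j`, and
every vector whose image has leading index `j` has a nonzero entry at some index `≤ p`
(`exists_image_of_col_ne_zero`, `exists_le_piv`).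

For `(D^L)^⊥` the first fact lists the latest simplices `c` of cycles of `L`. For `(D^f)^⊥` the
second says that a cycle with latest simplex `c` can be chosen to bound in `K` at time `k(pivsimp
s_c)`, and that none bounds earlier. Choose such a cycle `z_c` for every `c ∉ pivs R`, or any cycle
with leading index `c` if `s_c = 0` (`exists_adapted_cycle`). The `z_c` with `l(c) ≤ t` and `dim c =
d` span the `d`-cycles of `L_t`. The image of `H_d(f_t)` is the space of these cycles modulo those
whose image bounds in `K_t` (`imageClass_eq_zero_iff`). Hence the classes of those `z_c` that do not
yet bound form a basis, compatible with the structure maps: this is the barcode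
(`hasBarcode_image_homologyMap`). Finally `pivsimp w_c` and `pivsimp v_c` are the simplex with index
`c`, since `W` and `V` are triangular.

Clearing rests on one remark: column `j` can be zero in a reduction of `D` exactly if `ker D`
contains a vector with pivot `j` (`col_eq_zero_iff`), and that vector may replace column `j` of `V`.
For `(D^L)^⊥` the vector is an already reduced column, as `D² = 0`. For `(D^f)^⊥` it is supplied by
the reduction of `(D^L)^⊥`, since the two matrices differ by an invertible left factor and have the
same kernel. -/

theorem piv_ne_zero (c : Fin n → 𝔽) (hc : c ≠ 0) : c (piv c hc) ≠ 0 := by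
  classical
  have h := Finset.max'_mem (Finset.univ.filter fun i => c i ≠ 0) (by
    obtain ⟨i, hi⟩ := Function.ne_iff.1 hc
    exact ⟨i, by simpa using hi⟩)
  have h2 := (Finset.mem_filter.1 h).2
  unfold piv
  convert h2

theorem le_piv (c : Fin n → 𝔽) (hc : c ≠ 0) (i : Fin n) (hi : c i ≠ 0) : i ≤ piv c hc := by
  unfold piv
  exact Finset.le_max' _ _ (by simpa using hi)

theorem eq_zero_of_piv_lt (c : Fin n → 𝔽) (hc : c ≠ 0) (i : Fin n) (hi : piv c hc < i) :
    c i = 0 := by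
  by_contra h
  exact absurd (le_piv c hc i h) (not_le.2 hi)

theorem piv_eq_of (c : Fin n → 𝔽) (hc : c ≠ 0) (j : Fin n) (hj : c j ≠ 0)
    (h : ∀ i, j < i → c i = 0) : piv c hc = j := by
  refine le_antisymm ?_ (le_piv c hc j hj)
  by_contra hlt
  exact piv_ne_zero c hc (h _ (not_le.1 hlt))

theorem piv_congr {c c' : Fin n → 𝔽} (h : c = c') (hc : c ≠ 0) :
    piv c hc = piv c' (h ▸ hc) := by
  subst h; rfl

/-- The columns of a reduced matrix satisfy only trivial linear relations. -/
theorem IsColReduced.apply_eq_zero {X : Matrix (Fin n) (Fin n) 𝔽} (hX : IsColReduced X)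
    (c : Fin n → 𝔽) (h : X.mulVec c = 0) (j : Fin n) (hj : X.col j ≠ 0) : c j = 0 := by
  classical
  by_contra hcj
  let P : {j : Fin n // X.col j ≠ 0} → Fin n := fun j => piv (X.col j.1) j.2
  -- Among the nonzero columns occurring in the relation, take the one with the largest pivot. In
  -- the row of that pivot it contributes the only nonzero term.
  obtain ⟨⟨k, hk⟩, hkm, hmax⟩ := Finset.exists_max_image
    (Finset.univ.filter fun j : {j : Fin n // X.col j ≠ 0} => c j.1 ≠ 0) P
    ⟨⟨j, hj⟩, by simpa using hcj⟩
  have hck : c k ≠ 0 := by simpa using hkm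
  have h0 : ∑ i, X (piv (X.col k) hk) i * c i = 0 := congrFun h (piv (X.col k) hk)
  rw [Finset.sum_eq_single k] at h0
  · exact mul_ne_zero (piv_ne_zero (X.col k) hk) hck h0
  · intro i _ hik
    by_cases hci : c i = 0
    · rw [hci, mul_zero]
    by_cases hXi : X.col i = 0
    · rw [show X (piv (X.col k) hk) i = 0 from congrFun hXi _, zero_mul]
    have hle : piv (X.col i) hXi ≤ piv (X.col k) hk := hmax ⟨i, hXi⟩ (by simpa using hci)
    have hlt : piv (X.col i) hXi < piv (X.col k) hk :=
      lt_of_le_of_ne hle fun e => hik (hX i trivial k trivial hXi hk e)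
    rw [show X (piv (X.col k) hk) i = 0 from eq_zero_of_piv_lt (X.col i) hXi _ hlt, zero_mul]
  · simp

theorem rank_eq_of_upper {V : Matrix (Fin n) (Fin n) 𝔽} (hV : ∀ i j, j < i → V i j = 0)
    (hd : ∀ j, V j j ≠ 0) : V.rank = n := by
  have hdet : IsUnit V.det := by
    rw [Matrix.det_of_isUpperTriangular (fun i j h => hV i j h)]
    exact (Finset.prod_ne_zero_iff.2 fun j _ => hd j).isUnit
  rw [Matrix.rank_of_isUnit V ((Matrix.isUnit_iff_isUnit_det V).2 hdet), Fintype.card_fin]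

/-- If `V` is upper triangular with nonzero diagonal, then `y` and `Vᵀ y` have the same zero
initial segments. -/
theorem eq_zero_of_upper {V : Matrix (Fin n) (Fin n) 𝔽} (hV : ∀ i j, j < i → V i j = 0)
    (hd : ∀ j, V j j ≠ 0) (y : Fin n → 𝔽) (j : Fin n)
    (h : ∀ i < j, Vᵀ.mulVec y i = 0) : ∀ i < j, y i = 0 := by
  intro i
  induction i using WellFoundedLT.induction with
  | ind i ih =>
    intro hij
    have h1 : ∑ k, V k i * y k = 0 := h i hij
    rw [Finset.sum_eq_single i] at h1
    · exact (mul_eq_zero.1 h1).resolve_left (hd i)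
    · intro k _ hki
      rcases lt_or_gt_of_ne hki with hlt | hlt
      · rw [ih k hlt (hlt.trans hij), mul_zero]
      · rw [hV k i hlt, zero_mul]
    · simp

/-- Terms on one side of the diagonal vanish by triangularity and those on the other because `y`
starts at `j`. So `Vᵀ` only rescales a leading entry, which is why reductions of `D` see the leading
indices of `Dᵀ x`. -/
theorem upper_transpose_mulVec_apply {V : Matrix (Fin n) (Fin n) 𝔽}
    (hV : ∀ i j, j < i → V i j = 0) (y : Fin n → 𝔽) (j : Fin n) (h : ∀ i < j, y i = 0) :
    Vᵀ.mulVec y j = V j j * y j := by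
  change ∑ k, V k j * y k = V j j * y j
  refine Finset.sum_eq_single j (fun k _ hkj => ?_) (by simp)
  rcases lt_or_gt_of_ne hkj with hlt | hlt
  · rw [h k hlt, mul_zero]
  · rw [hV k j hlt, zero_mul]

theorem eq_zero_of_upper_mulVec {V : Matrix (Fin n) (Fin n) 𝔽} (hV : ∀ i j, j < i → V i j = 0)
    (hd : ∀ j, V j j ≠ 0) (y : Fin n → 𝔽) (h : Vᵀ.mulVec y = 0) : y = 0 := by
  have hmax : ∀ j, y j = 0 := fun j => by
    have h1 : ∀ i < j, y i = 0 := eq_zero_of_upper hV hd y j fun i _ => congrFun h i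
    have h2 := upper_transpose_mulVec_apply hV y j h1
    rw [h] at h2
    exact (mul_eq_zero.1 h2.symm).resolve_left (hd j)
  exact funext hmax

namespace Reduction

variable {D : Matrix (Fin n) (Fin n) 𝔽} (ρ : Reduction D)

include ρ in
theorem diag_ne_zero (j : Fin n) : ρ.V j j ≠ 0 := by
  have hdet : IsUnit ρ.V.det := by
    have hli : LinearIndependent 𝔽 ρ.V.col := by
      rw [linearIndependent_iff_card_eq_finrank_span, Set.finrank,
        ← Matrix.rank_eq_finrank_span_cols, ρ.full_rank, Fintype.card_fin]
    exact (Matrix.isUnit_iff_isUnit_det _).1 (Matrix.linearIndependent_cols_iff_isUnit.1 hli)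
  rw [Matrix.det_of_isUpperTriangular (fun i j h => ρ.upper i j h)] at hdet
  exact Finset.prod_ne_zero_iff.1 hdet.ne_zero j (Finset.mem_univ j)

theorem piv_V_col (j : Fin n) : piv (ρ.V.col j) (ρ.V_col_ne_zero j) = j :=
  piv_eq_of _ _ j (ρ.diag_ne_zero j) fun i hi => ρ.upper i j hi

theorem R_col (j : Fin n) : ρ.R.col j = D.mulVec (ρ.V.col j) := by
  rw [ρ.eq_mul]
  rfl

theorem transpose_mulVec (x : Fin n → 𝔽) :
    ρ.Rᵀ.mulVec x = ρ.Vᵀ.mulVec (Dᵀ.mulVec x) := by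
  rw [ρ.eq_mul, Matrix.transpose_mul, Matrix.mulVec_mulVec]

/-- The zero columns of `R` are intrinsic. -/
theorem col_eq_zero_iff (j : Fin n) :
    ρ.R.col j = 0 ↔ ∃ w : Fin n → 𝔽, w j ≠ 0 ∧ (∀ i, j < i → w i = 0) ∧ D.mulVec w = 0 := by
  constructor
  · intro h
    exact ⟨ρ.V.col j, ρ.diag_ne_zero j, fun i hi => ρ.upper i j hi, by rw [← ρ.R_col, h]⟩
  · rintro ⟨w, hwj, hw, hDw⟩
    have hu : IsUnit ρ.V.det := by
      rw [Matrix.det_of_isUpperTriangular (fun i j h => ρ.upper i j h)]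
      exact (Finset.prod_ne_zero_iff.2 fun j _ => ρ.diag_ne_zero j).isUnit
    -- In terms of the columns of `V`, `w` has coefficients `c` whose last nonzero entry is again at
    -- `j`. They form a relation among the columns of the reduced matrix `R`, so `r_j ≠ 0` would
    -- force `c j = 0`.
    set c := ρ.V⁻¹.mulVec w with hc
    have hVc : ρ.V.mulVec c = w := by
      rw [hc, Matrix.mulVec_mulVec, Matrix.mul_nonsing_inv _ hu, Matrix.one_mulVec]
    have hRc : ρ.R.mulVec c = 0 := by
      rw [ρ.eq_mul, ← Matrix.mulVec_mulVec, hVc, hDw]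
    have htop : ∀ i, j < i → c i = 0 := by
      intro i
      induction i using WellFoundedGT.induction with
      | ind i ih =>
        intro hij
        have h1 : ∑ k, ρ.V i k * c k = 0 := (congrFun hVc i).trans (hw i hij)
        rw [Finset.sum_eq_single i] at h1
        · exact (mul_eq_zero.1 h1).resolve_left (ρ.diag_ne_zero i)
        · intro k _ hki
          rcases lt_or_gt_of_ne hki with hlt | hlt
          · rw [ρ.upper i k hlt, zero_mul]
          · rw [ih k hlt (hij.trans hlt), mul_zero]
        · simp
    have hcj : c j ≠ 0 := by
      intro h0
      apply hwj
      rw [← hVc]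
      change ∑ k, ρ.V j k * c k = 0
      refine Finset.sum_eq_zero fun k _ => ?_
      rcases lt_trichotomy k j with hlt | rfl | hlt
      · rw [ρ.upper j k hlt, zero_mul]
      · rw [h0, mul_zero]
      · rw [htop k hlt, mul_zero]
    by_contra hne
    exact hcj (ρ.reduced.apply_eq_zero c hRc j hne)

/-- The leading index of `Dᵀ x` determines a nonzero column of `R`, and its pivot bounds the
support of `x`. -/
theorem exists_le_piv (x : Fin n → 𝔽) (j : Fin n) (h0 : ∀ i < j, Dᵀ.mulVec x i = 0)
    (hj : Dᵀ.mulVec x j ≠ 0) :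
    ∃ h : ρ.R.col j ≠ 0, ∃ i ≤ piv (ρ.R.col j) h, x i ≠ 0 := by
  have h1 : ∑ i, ρ.R i j * x i ≠ 0 := by
    change ρ.Rᵀ.mulVec x j ≠ 0
    rw [ρ.transpose_mulVec, upper_transpose_mulVec_apply ρ.upper _ j h0]
    exact mul_ne_zero (ρ.diag_ne_zero j) hj
  obtain ⟨i, -, hi⟩ := Finset.exists_ne_zero_of_sum_ne_zero h1
  have hRi : ρ.R.col j i ≠ 0 := left_ne_zero_of_mul hi
  have hR : ρ.R.col j ≠ 0 := fun h => hRi (by rw [h]; rfl)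
  exact ⟨hR, i, le_piv _ hR i hRi, right_ne_zero_of_mul hi⟩

end Reduction

/-- For a reduced matrix, a vector with leading entry `1` at `c` that is orthogonal to all columns
whose pivot is not `c`. -/
theorem IsColReduced.exists_orthogonal {X : Matrix (Fin n) (Fin n) 𝔽} (hX : IsColReduced X)
    (c : Fin n) : ∃ x : Fin n → 𝔽, x c = 1 ∧ (∀ i < c, x i = 0) ∧
      ∀ j, (∀ h : X.col j ≠ 0, piv (X.col j) h ≠ c) → Xᵀ.mulVec x j = 0 := by
  classical
  -- Start with the unit vector at `c` and treat the pivots `p > c` in increasing order. A multiple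
  -- of the unit vector at `p` makes `x` orthogonal to the column with pivot `p`; columns with
  -- smaller pivots vanish at `p`, so earlier corrections survive.
  have key : ∀ m : ℕ, ∃ x : Fin n → 𝔽, x c = 1 ∧ (∀ i < c, x i = 0) ∧
      ∀ j (h : X.col j ≠ 0), c < piv (X.col j) h → (piv (X.col j) h : ℕ) < m →
        Xᵀ.mulVec x j = 0 := by
    intro m
    induction m with
    | zero =>
      exact ⟨Pi.single c 1, by simp, fun i hi => by simp [hi.ne], fun j h _ h' => by omega⟩
    | succ m ih =>
      obtain ⟨x, hxc, hx0, hx⟩ := ih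
      by_cases hm : ∃ j, ∃ h : X.col j ≠ 0, c < piv (X.col j) h ∧ (piv (X.col j) h : ℕ) = m
      · obtain ⟨j, h, hcj, hjm⟩ := hm
        set p := piv (X.col j) h with hp
        have hXp : X p j ≠ 0 := piv_ne_zero (X.col j) h
        refine ⟨x + Pi.single p (-(Xᵀ.mulVec x j) / X p j), ?_, ?_, ?_⟩
        · simp [hxc, hcj.ne]
        · intro i hi
          simp [hx0 i hi, (hi.trans hcj).ne]
        · intro j' h' hc' hm'
          rw [Matrix.mulVec_add, Pi.add_apply, Matrix.mulVec_single]
          simp only [Pi.smul_apply, Matrix.col_apply, Matrix.transpose_apply,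
            MulOpposite.smul_eq_mul_unop, MulOpposite.unop_op]
          by_cases hjj : j' = j
          · subst hjj
            field_simp
            ring
          · have hne : piv (X.col j') h' ≠ p := fun e =>
              hjj (hX j' trivial j trivial h' h e)
            have hlt : piv (X.col j') h' < p := by
              refine lt_of_le_of_ne ?_ hne
              rw [Fin.le_def]; omega
            rw [show X p j' = 0 from eq_zero_of_piv_lt (X.col j') h' p hlt, zero_mul, add_zero]
            exact hx j' h' hc' (by rw [← hjm]; exact hlt)
      · refine ⟨x, hxc, hx0, fun j h hc hlt => hx j h hc ?_⟩
        rcases Nat.lt_succ_iff_lt_or_eq.1 hlt with h1 | h1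
        · exact h1
        · exact absurd ⟨j, h, hc, h1⟩ hm
  obtain ⟨x, hxc, hx0, hx⟩ := key n
  refine ⟨x, hxc, hx0, fun j hj => ?_⟩
  by_cases h : X.col j = 0
  · change ∑ i, X i j * x i = 0
    exact Finset.sum_eq_zero fun i _ => by rw [show X i j = 0 from congrFun h i, zero_mul]
  rcases lt_or_gt_of_ne (hj h) with hlt | hlt
  · change ∑ i, X i j * x i = 0
    refine Finset.sum_eq_zero fun i _ => ?_
    rcases lt_or_ge i c with hi | hi
    · rw [hx0 i hi, mul_zero]
    · rw [show X i j = 0 from eq_zero_of_piv_lt (X.col j) h i (hlt.trans_le hi), zero_mul]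
  · exact hx j h hlt (piv (X.col j) h).2

namespace Reduction

variable {D : Matrix (Fin n) (Fin n) 𝔽} (ρ : Reduction D)

/-- The pivot of a nonzero column `r_j` supports a preimage of a vector with leading index `j`. -/
theorem exists_image_of_col_ne_zero (j : Fin n) (h : ρ.R.col j ≠ 0) :
    ∃ x : Fin n → 𝔽, (∀ i < piv (ρ.R.col j) h, x i = 0) ∧
      (∀ i < j, Dᵀ.mulVec x i = 0) ∧ Dᵀ.mulVec x j ≠ 0 := by
  -- By reducedness `r_j` is the only nonzero column with this pivot. So `Rᵀ x` is concentrated at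
  -- `j`, and undoing `Vᵀ` keeps `j` as leading index.
  obtain ⟨x, hxc, hx0, hx⟩ := ρ.reduced.exists_orthogonal (piv (ρ.R.col j) h)
  have h1 : ∀ i < j, Dᵀ.mulVec x i = 0 := by
    refine eq_zero_of_upper ρ.upper ρ.diag_ne_zero _ j fun i hi => ?_
    rw [← ρ.transpose_mulVec]
    exact hx i fun h' e => hi.ne (ρ.reduced i trivial j trivial h' h e)
  refine ⟨x, hx0, h1, fun h0 => ?_⟩
  have h2 := upper_transpose_mulVec_apply ρ.upper _ j h1
  rw [h0, mul_zero, ← ρ.transpose_mulVec] at h2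
  have h3 : ∑ i, ρ.R i j * x i = 0 := h2
  rw [Finset.sum_eq_single (piv (ρ.R.col j) h)] at h3
  · rw [hxc, mul_one] at h3
    exact piv_ne_zero _ h h3
  · intro i _ hi
    rcases lt_or_gt_of_ne hi with hlt | hlt
    · rw [hx0 i hlt, mul_zero]
    · rw [show ρ.R i j = 0 from eq_zero_of_piv_lt (ρ.R.col j) h i hlt, zero_mul]
  · simp

/-- An index that is not a pivot of `R` is the leading index of a vector in the kernel of `Dᵀ`. -/
theorem exists_ker_of_notMem_pivs (c : Fin n) (hc : c ∉ pivs ρ.R) :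
    ∃ x : Fin n → 𝔽, x c ≠ 0 ∧ (∀ i < c, x i = 0) ∧ Dᵀ.mulVec x = 0 := by
  obtain ⟨x, hxc, hx0, hx⟩ := ρ.reduced.exists_orthogonal c
  refine ⟨x, by simp [hxc], hx0, eq_zero_of_upper_mulVec ρ.upper ρ.diag_ne_zero _ ?_⟩
  rw [← ρ.transpose_mulVec]
  exact funext fun j => hx j fun h e => hc ⟨j, h, e⟩

/-- The leading index of a vector in the kernel of `Dᵀ` is not a pivot of `R`. -/
theorem notMem_pivs_of_ker (x : Fin n → 𝔽) (c : Fin n) (hxc : x c ≠ 0) (hx0 : ∀ i < c, x i = 0)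
    (hD : Dᵀ.mulVec x = 0) : c ∉ pivs ρ.R := by
  rintro ⟨j, h, rfl⟩
  have h3 : ∑ i, ρ.R i j * x i = 0 := by
    change ρ.Rᵀ.mulVec x j = 0
    rw [ρ.transpose_mulVec, hD, Matrix.mulVec_zero]; rfl
  rw [Finset.sum_eq_single (piv (ρ.R.col j) h)] at h3
  · exact mul_ne_zero (piv_ne_zero _ h) hxc h3
  · intro i _ hi
    rcases lt_or_gt_of_ne hi with hlt | hlt
    · rw [hx0 i hlt, mul_zero]
    · rw [show ρ.R i j = 0 from eq_zero_of_piv_lt (ρ.R.col j) h i hlt, zero_mul]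
  · simp

end Reduction

end Pivots

/-! ### Column operations and clearing -/

section ColumnOperations

open scoped Matrix

theorem col_updateCol_self {α : Type v} {n : ℕ}
    (X : Matrix (Fin n) (Fin n) α) (j : Fin n) (c : Fin n → α) :
    (X.updateCol j c).col j = c := by
  ext i; simp

theorem col_updateCol_of_ne {α : Type v} {n : ℕ}
    (X : Matrix (Fin n) (Fin n) α) {i j : Fin n} (h : i ≠ j)
    (c : Fin n → α) : (X.updateCol j c).col i = X.col i := by
  ext k; simp [h]

variable {𝔽 : Type v} [Field 𝔽] {n : ℕ}

theorem ColumnOps.col_eq {s : Set (Fin n)} {X Y : Matrix (Fin n) (Fin n) 𝔽}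
    (h : ColumnOps s X Y) {j : Fin n} (hj : j ∉ s) : Y.col j = X.col j := by
  induction h with
  | refl => rfl
  | tail _ hop ih =>
    rw [← ih]
    cases hop with
    | scale k a hk ha => exact col_updateCol_of_ne _ (fun e : j = k => hj (e.symm ▸ hk)) _
    | add i k a hi hk hik => exact col_updateCol_of_ne _ (fun e : j = k => hj (e.symm ▸ hk)) _

/-- The bound `m` on the pivot of column `k` is the measure of termination: adding a multiple of an
earlier column with the same pivot cancels that entry, so the pivot drops or the column vanishes. -/
theorem exists_columnOps_reduce_col (s : Set (Fin n)) (k : Fin n) (hk : k ∈ s) (m : ℕ)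
    (X : Matrix (Fin n) (Fin n) 𝔽) (hm : ∀ h : X.col k ≠ 0, (piv (X.col k) h : ℕ) < m) :
    ∃ Y, ColumnOps s X Y ∧ (∀ j, j ≠ k → Y.col j = X.col j) ∧
      ∀ i ∈ s, i < k → ∀ (hi : Y.col i ≠ 0) (hk : Y.col k ≠ 0),
        piv (Y.col i) hi ≠ piv (Y.col k) hk := by
  induction m generalizing X with
  | zero => exact ⟨X, .refl, fun _ _ => rfl, fun i _ _ _ hk => absurd (hm hk) (Nat.not_lt_zero _)⟩
  | succ m ih =>
    by_cases hc : ∃ i ∈ s, i < k ∧ ∃ (hi : X.col i ≠ 0) (hk : X.col k ≠ 0),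
        piv (X.col i) hi = piv (X.col k) hk
    · obtain ⟨i, his, hik, hi, hk0, hp⟩ := hc
      set p := piv (X.col k) hk0 with hpdef
      have hXpi : X.col i p ≠ 0 := by rw [← hp]; exact piv_ne_zero _ hi
      set a := -(X.col k p) / X.col i p with ha
      obtain ⟨Y, hY1, hY2, hY3⟩ := ih (X.updateCol k (X.col k + a • X.col i)) (by
        rw [col_updateCol_self]
        intro h
        have hlt : piv (X.col k + a • X.col i) h < p := by
          by_contra hge
          apply piv_ne_zero _ h
          rcases (not_lt.1 hge).eq_or_lt with he | hlt
          · rw [← he, Pi.add_apply, Pi.smul_apply, smul_eq_mul, ha]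
            field_simp
            ring
          · rw [Pi.add_apply, Pi.smul_apply, eq_zero_of_piv_lt (X.col k) hk0 _ hlt,
              eq_zero_of_piv_lt (X.col i) hi _ (hp ▸ hlt), smul_zero, add_zero]
        have := hm hk0
        rw [Fin.lt_def] at hlt
        omega)
      refine ⟨Y, Relation.ReflTransGen.head (ColumnOp.add X i k a his hk hik) hY1,
        fun j hj => ?_, hY3⟩
      rw [hY2 j hj, col_updateCol_of_ne _ hj]
    · exact ⟨X, .refl, fun _ _ => rfl, fun i his hik hi hk e => hc ⟨i, his, hik, hi, hk, e⟩⟩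

/-- Gaussian elimination by left-to-right column operations. -/
theorem exists_columnOps_isColReducedOn (s : Set (Fin n)) (X : Matrix (Fin n) (Fin n) 𝔽) :
    ∃ Y, ColumnOps s X Y ∧ IsColReducedOn s Y := by
  have key : ∀ m : ℕ, ∃ Y, ColumnOps s X Y ∧ IsColReducedOn {i | i ∈ s ∧ (i : ℕ) < m} Y := by
    intro m
    induction m with
    | zero => exact ⟨X, .refl, fun i hi => absurd hi.2 (Nat.not_lt_zero _)⟩
    | succ m ih =>
      obtain ⟨Y, hXY, hY⟩ := ih
      by_cases hms : ∃ k ∈ s, (k : ℕ) = m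
      · obtain ⟨k, hk, rfl⟩ := hms
        obtain ⟨Z, hYZ, hZ1, hZ2⟩ := exists_columnOps_reduce_col s k hk n Y fun h => Fin.isLt _
        refine ⟨Z, hXY.trans hYZ, ?_⟩
        rintro i ⟨his, hi⟩ j ⟨hjs, hj⟩ hi0 hj0 hp
        rcases Nat.lt_succ_iff_lt_or_eq.1 hi with hik | hik <;>
          rcases Nat.lt_succ_iff_lt_or_eq.1 hj with hjk | hjk
        · have ei := hZ1 i (fun e => by subst e; omega)
          have ej := hZ1 j (fun e => by subst e; omega)
          refine hY i ⟨his, hik⟩ j ⟨hjs, hjk⟩ (ei ▸ hi0) (ej ▸ hj0) ?_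
          rw [piv_congr ei.symm, piv_congr ej.symm]
          exact hp
        · obtain rfl : j = k := Fin.ext hjk
          exact absurd hp (hZ2 i his hik hi0 hj0)
        · obtain rfl : i = k := Fin.ext hik
          exact absurd hp.symm (hZ2 j hjs hjk hj0 hi0)
        · exact Fin.ext (hik.trans hjk.symm)
      · refine ⟨Y, hXY, ?_⟩
        have hset : {i : Fin n | i ∈ s ∧ (i : ℕ) < m + 1} = {i | i ∈ s ∧ (i : ℕ) < m} := by
          ext i
          refine and_congr_right fun his => ⟨fun hi => ?_, fun hi => Nat.lt_succ_of_lt hi⟩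
          exact lt_of_le_of_ne (Nat.lt_succ_iff.1 hi) fun e => hms ⟨i, his, e⟩
        rwa [hset]
  obtain ⟨Y, hXY, hY⟩ := key n
  exact ⟨Y, hXY, fun i hi j hj => hY i ⟨hi, i.2⟩ j ⟨hj, j.2⟩⟩

/-- `X` arises from `D` by multiplication with an invertible upper triangular matrix that respects
the degrees of the columns. -/
def IsUpperMultiple (deg : Fin n → ℕ) (D X : Matrix (Fin n) (Fin n) 𝔽) : Prop :=
  ∃ V : Matrix (Fin n) (Fin n) 𝔽, X = D * V ∧ (∀ i j, j < i → V i j = 0) ∧ (∀ j, V j j ≠ 0) ∧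
    ∀ i j, V i j ≠ 0 → deg i = deg j

/-- An operation on the columns of `D * V` is the same operation on `V`. Left-to-right operations
keep `V` triangular with nonzero diagonal, and mixing only columns of one degree keeps it
homogeneous. -/
theorem ColumnOps.isUpperMultiple {deg : Fin n → ℕ} {s : Set (Fin n)}
    {D X Y : Matrix (Fin n) (Fin n) 𝔽} (h : ColumnOps s X Y)
    (hs : ∀ i ∈ s, ∀ j ∈ s, deg i = deg j) (hX : IsUpperMultiple deg D X) :
    IsUpperMultiple deg D Y := by
  induction h with
  | refl => exact hX
  | tail _ hop ih =>
    obtain ⟨V, rfl, hup, hd, hdeg⟩ := ih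
    have hcol : ∀ j, (D * V).col j = D.mulVec (V.col j) := fun _ => rfl
    cases hop with
    | scale k a hk ha =>
      refine ⟨V.updateCol k (a • V.col k), ?_, fun i j hij => ?_, fun j => ?_, fun i j hij => ?_⟩
      · rw [Matrix.mul_updateCol, hcol, Matrix.mulVec_smul]
      · by_cases h : j = k
        · subst h; simp [hup i j hij]
        · simp [h, hup i j hij]
      · by_cases h : j = k
        · subst h; simp [ha, hd j]
        · simp [h, hd j]
      · by_cases h : j = k
        · subst h
          simp only [Matrix.updateCol_self, Pi.smul_apply, smul_eq_mul] at hij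
          exact hdeg i j (right_ne_zero_of_mul hij)
        · exact hdeg i j (by simpa [h] using hij)
    | add l k a hl hk hlk =>
      refine ⟨V.updateCol k (V.col k + a • V.col l), ?_, fun i j hij => ?_, fun j => ?_,
        fun i j hij => ?_⟩
      · rw [Matrix.mul_updateCol, hcol, hcol, Matrix.mulVec_add, Matrix.mulVec_smul]
      · by_cases h : j = k
        · subst h; simp [hup i j hij, hup i l (hlk.trans hij)]
        · simp [h, hup i j hij]
      · by_cases h : j = k
        · subst h; simp [hup j l hlk, hd j]
        · simp [h, hd j]
      · by_cases h : j = k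
        · subst h
          simp only [Matrix.updateCol_self, Pi.add_apply, Pi.smul_apply, smul_eq_mul,
            Matrix.col_apply] at hij
          by_cases h1 : V i j = 0
          · rw [h1, zero_add] at hij
            rw [hdeg i l (right_ne_zero_of_mul hij), hs l hl j hk]
          · exact hdeg i j h1
        · exact hdeg i j (by simpa [h] using hij)

theorem IsUpperMultiple.exists_reduction {deg : Fin n → ℕ} {D X : Matrix (Fin n) (Fin n) 𝔽}
    (h : IsUpperMultiple deg D X) (hX : IsColReduced X) : ∃ R : Reduction D, R.R = X := by
  obtain ⟨V, hV, hup, hd, -⟩ := h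
  exact ⟨⟨X, V, hV, hup, rank_eq_of_upper hup hd, hX⟩, rfl⟩

/-- Replacing columns of `V` by elements of the kernel of `D` with the same leading index clears
the corresponding columns of `D * V`. -/
theorem IsUpperMultiple.clearColumns {deg : Fin n → ℕ} {D X : Matrix (Fin n) (Fin n) 𝔽}
    (h : IsUpperMultiple deg D X) (Z : Set (Fin n))
    (hZ : ∀ j ∈ Z, ∃ w : Fin n → 𝔽, w j ≠ 0 ∧ (∀ i, j < i → w i = 0) ∧
      (∀ i, w i ≠ 0 → deg i = deg j) ∧ D.mulVec w = 0) :
    IsUpperMultiple deg D (clearColumns Z X) := by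
  classical
  obtain ⟨V, rfl, hup, hd, hdeg⟩ := h
  choose! w hwj hw hwdeg hDw using hZ
  refine ⟨Matrix.of fun i j => if j ∈ Z then w j i else V i j, ?_, fun i j hij => ?_, fun j => ?_,
    fun i j hij => ?_⟩
  · ext i j
    by_cases hj : j ∈ Z
    · have h0 : ∑ k, D i k * w j k = 0 := congrFun (hDw j hj) i
      simp [_root_.clearColumns, Matrix.mul_apply, hj, h0]
    · simp [_root_.clearColumns, Matrix.mul_apply, hj]
  · by_cases hj : j ∈ Z
    · simp [hj, hw j hj i hij]
    · simp [hj, hup i j hij]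
  · by_cases hj : j ∈ Z
    · simp [hj, hwj j hj]
    · simp [hj, hd j]
  · by_cases hj : j ∈ Z
    · exact hwdeg j hj i (by simpa [hj] using hij)
    · exact hdeg i j (by simpa [hj] using hij)

theorem col_clearColumns_of_mem {Z : Set (Fin n)} (X : Matrix (Fin n) (Fin n) 𝔽) {j : Fin n}
    (hj : j ∈ Z) : (clearColumns Z X).col j = 0 := by
  ext i; simp [clearColumns, hj]

theorem col_clearColumns_of_notMem {Z : Set (Fin n)} (X : Matrix (Fin n) (Fin n) 𝔽) {j : Fin n}
    (hj : j ∉ Z) : (clearColumns Z X).col j = X.col j := by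
  ext i; simp [clearColumns, hj]

theorem isUpperMultiple_refl (deg : Fin n → ℕ) (D : Matrix (Fin n) (Fin n) 𝔽) :
    IsUpperMultiple deg D D :=
  ⟨1, by simp, fun i j h => Matrix.one_apply_ne h.ne', fun j => by simp, fun i j h => by
    by_contra hne
    exact h (Matrix.one_apply_ne fun e => hne (by rw [e]))⟩

/-- The invariant of a reduction with clearing. -/
theorem ClearingRun.invariant {deg : Fin n → ℕ} {D : Matrix (Fin n) (Fin n) 𝔽} (hDD : D * D = 0)
    (hdeg : ∀ i j, D i j ≠ 0 → deg i = deg j + 1) {d : ℕ} {X : Matrix (Fin n) (Fin n) 𝔽}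
    (h : ClearingRun deg D d X) :
    IsUpperMultiple deg D X ∧ ∀ e < d, IsColReducedOn {j | deg j = e} X := by
  induction h with
  | start => exact ⟨isUpperMultiple_refl deg D, fun e he => absurd he (Nat.not_lt_zero e)⟩
  | step d X Y _ hops hred ih =>
    obtain ⟨hX, hXred⟩ := ih
    constructor
    · refine hops.isUpperMultiple (fun i hi j hj => hi.1.trans hj.1.symm) (hX.clearColumns _ ?_)
      rintro j ⟨hj, i, hi, hid, rfl⟩
      obtain ⟨V, rfl, hup, hd, hVdeg⟩ := hX
      -- The kernel vector with pivot `j` is the reduced column of degree `d - 1` itself: it is an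
      -- image under `D`, and `D * D = 0`.
      refine ⟨_, piv_ne_zero _ hi, fun k hk => eq_zero_of_piv_lt _ hi k hk, fun k hk => ?_, ?_⟩
      · obtain ⟨l, -, hl⟩ := Finset.exists_ne_zero_of_sum_ne_zero
          (show ∑ l, D k l * V l i ≠ 0 from hk)
        rw [hj, hdeg k l (left_ne_zero_of_mul hl), hVdeg l i (right_ne_zero_of_mul hl), hid]
      · change D.mulVec (D.mulVec (V.col i)) = 0
        rw [Matrix.mulVec_mulVec, hDD, Matrix.zero_mulVec]
    · intro e he
      rcases Nat.lt_succ_iff_lt_or_eq.1 he with hlt | rfl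
      · have hcol : ∀ j, deg j = e → Y.col j = X.col j := fun j hj => by
          rw [hops.col_eq (fun h => by have := h.1; omega),
            col_clearColumns_of_notMem _ (fun h => by have := h.1; omega)]
        intro i hi j hj hi0 hj0 hp
        have ei := hcol i hi
        have ej := hcol j hj
        refine hXred e hlt i hi j hj (ei ▸ hi0) (ej ▸ hj0) ?_
        rw [piv_congr ei.symm, piv_congr ej.symm]
        exact hp
      · exact hred

theorem ClearingRun.exists_step {deg : Fin n → ℕ} {D : Matrix (Fin n) (Fin n) 𝔽} {d : ℕ}
    {X : Matrix (Fin n) (Fin n) 𝔽} (h : ClearingRun deg D d X) :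
    ∃ Y, ClearingRun deg D (d + 1) Y ∧
      ColumnOps {j | deg j = d ∧ j ∉ clearedIn deg d X} (clearColumns (clearedIn deg d X) X) Y := by
  obtain ⟨Y, hops, hred⟩ := exists_columnOps_isColReducedOn
    {j | deg j = d ∧ j ∉ clearedIn deg d X} (clearColumns (clearedIn deg d X) X)
  refine ⟨Y, .step d X Y h hops fun i hi j hj hi0 hj0 hp => ?_, hops⟩
  -- Cleared columns take no part in the operations and stay zero, so every nonzero column of degree
  -- `d` was among the reduced ones.
  have hmem : ∀ k, deg k = d → Y.col k ≠ 0 → k ∈ {j | deg j = d ∧ j ∉ clearedIn deg d X} := by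
    refine fun k hk hk0 => ⟨hk, fun hc => hk0 ?_⟩
    rw [hops.col_eq (fun h => h.2 hc), col_clearColumns_of_mem _ hc]
  exact hred i (hmem i hi hi0) j (hmem j hj hj0) hi0 hj0 hp

/-- Distinct pivots within each degree suffice: the pivot of a column of degree `e` has degree `e +
1`, so columns of different degrees never share a pivot. -/
theorem ClearingRun.exists_reduction {deg : Fin n → ℕ} {D : Matrix (Fin n) (Fin n) 𝔽}
    (hDD : D * D = 0) (hdeg : ∀ i j, D i j ≠ 0 → deg i = deg j + 1) {d : ℕ}
    {X : Matrix (Fin n) (Fin n) 𝔽} (h : ClearingRun deg D d X) (hd : ∀ j, deg j < d) :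
    ∃ R : Reduction D, R.R = X := by
  obtain ⟨hX, hred⟩ := h.invariant hDD hdeg
  refine hX.exists_reduction fun i _ j _ hi hj hp => ?_
  obtain ⟨V, rfl, hup, hd', hVdeg⟩ := hX
  have hpd : ∀ (j : Fin n) (hj : (D * V).col j ≠ 0), deg (piv ((D * V).col j) hj) = deg j + 1 := by
    intro j hj
    obtain ⟨l, -, hl⟩ := Finset.exists_ne_zero_of_sum_ne_zero
      (show ∑ l, D _ l * V l j ≠ 0 from piv_ne_zero _ hj)
    rw [hdeg _ l (left_ne_zero_of_mul hl), hVdeg l j (right_ne_zero_of_mul hl)]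
  have h1 := hpd i hi
  rw [hp, hpd j hj] at h1
  exact hred (deg j) (hd j) i (by simp only [Set.mem_ofPred_eq]; omega) j rfl hi hj hp

/-- Reduction with clearing of a matrix `G * D` with `G` invertible, by means of a reduction
of `D`. -/
theorem Reduction.clearColumns_mul {D G : Matrix (Fin n) (Fin n) 𝔽} (ρ : Reduction D)
    (hG : IsUnit G) :
    (∃ X, ColumnOps {j | ρ.R.col j ≠ 0} (clearColumns {j | ρ.R.col j = 0} (G * D)) X ∧
      IsColReduced X) ∧
    ∀ X, ColumnOps {j | ρ.R.col j ≠ 0} (clearColumns {j | ρ.R.col j = 0} (G * D)) X →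
      (∀ j, X.col j = 0 ↔ ρ.R.col j = 0) ∧
      (IsColReduced X → ∃ S : Reduction (G * D), S.R = X) := by
  have hzero : ∀ X, ColumnOps {j | ρ.R.col j ≠ 0} (clearColumns {j | ρ.R.col j = 0} (G * D)) X →
      ∀ j, ρ.R.col j = 0 → X.col j = 0 := fun X hX j hj => by
    rw [hX.col_eq (fun h => h hj), col_clearColumns_of_mem _ hj]
  refine ⟨?_, fun X hX => ?_⟩
  · obtain ⟨X, hops, hred⟩ := exists_columnOps_isColReducedOn {j | ρ.R.col j ≠ 0}
      (clearColumns {j | ρ.R.col j = 0} (G * D))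
    exact ⟨X, hops, fun i _ j _ hi hj => hred i (fun h => hi (hzero X hops i h)) j
      (fun h => hj (hzero X hops j h)) hi hj⟩
  · have hup : IsUpperMultiple (fun _ => 0) (G * D) X := by
      refine hX.isUpperMultiple (fun _ _ _ _ => rfl)
        ((isUpperMultiple_refl _ _).clearColumns _ fun j hj => ?_)
      obtain ⟨w, h1, h2, h3⟩ := (ρ.col_eq_zero_iff j).1 hj
      exact ⟨w, h1, h2, fun _ _ => rfl, by rw [← Matrix.mulVec_mulVec, h3, Matrix.mulVec_zero]⟩
    refine ⟨fun j => ⟨fun hj => ?_, hzero X hX j⟩, hup.exists_reduction⟩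
    -- If column `j` became zero, column `j` of `V` would be a vector with pivot `j` in the kernel
    -- of `G * D`, hence of `D`, forcing `r_j = 0`.
    obtain ⟨V, rfl, hV, hd, -⟩ := hup
    refine (ρ.col_eq_zero_iff j).2 ⟨V.col j, hd j, fun i hi => hV i j hi, ?_⟩
    have h1 : G.mulVec (D.mulVec (V.col j)) = G.mulVec 0 := by
      rw [Matrix.mulVec_mulVec, Matrix.mulVec_zero]
      exact hj
    exact Matrix.mulVec_injective_of_isUnit hG h1

end ColumnOperations

/-! ### Criteria for barcodes -/

section Barcodes

variable {𝔽 : Type v} [Field 𝔽] {N : ℕ}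

theorem intervalValue_eq_zero {I : TInterval N} {t : Fin (N + 1)} (ht : t ∉ I.1)
    (c : intervalValue 𝔽 I t) : c = 0 := by
  have hc := c.2
  simp only [intervalValue, ht, if_false, Submodule.mem_bot] at hc
  exact Subtype.ext hc

theorem mem_intervalValue {I : TInterval N} {t : Fin (N + 1)} (ht : t ∈ I.1) (c : 𝔽) :
    c ∈ intervalValue 𝔽 I t := by
  simp [intervalValue, ht]

/-- The map out of a direct sum of interval modules determined by a family of elements. -/
noncomputable def intervalSumMap {X : Type w} [AddCommGroup X] [Module 𝔽 X] {A : Type}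
    (I : A → TInterval N) (t : Fin (N + 1)) (m : A → X) :
    (DirectSum A fun a => intervalValue 𝔽 (I a) t) →ₗ[𝔽] X :=
  open Classical in
  DirectSum.toModule 𝔽 A X fun a =>
    (LinearMap.toSpanSingleton 𝔽 X (m a)).comp (intervalValue 𝔽 (I a) t).subtype

theorem intervalSumMap_apply {X : Type w} [AddCommGroup X] [Module 𝔽 X] {A : Type} [Fintype A]
    (I : A → TInterval N) (t : Fin (N + 1)) (m : A → X)
    (y : DirectSum A fun a => intervalValue 𝔽 (I a) t) :
    intervalSumMap I t m y = ∑ a, ((y a : intervalValue 𝔽 (I a) t) : 𝔽) • m a := by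
  classical
  conv_lhs => rw [← DirectSum.sum_univ_of y]
  rw [map_sum]
  refine Finset.sum_congr rfl fun a _ => ?_
  change intervalSumMap I t m (DirectSum.lof 𝔽 A (fun a => intervalValue 𝔽 (I a) t) a (y a)) = _
  rw [intervalSumMap]
  exact DirectSum.toModule_lof (M := fun a => intervalValue 𝔽 (I a) t) 𝔽 a (y a)

/-- A persistence module with a compatible family of elements that form bases has the
corresponding barcode. -/
theorem PersMod.HasBarcode.of_basis {M : PersMod.{v, w} 𝔽 N} {A : Type} [Fintype A]
    (I : A → TInterval N) (m : A → ∀ t, M.obj t)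
    (hzero : ∀ a t, t ∉ (I a).1 → m a t = 0)
    (hmap : ∀ a (s t : Fin (N + 1)) (g : s ⟶ t), s ∈ (I a).1 → (M.map g).hom (m a s) = m a t)
    (hspan : ∀ t (x : M.obj t), ∃ c : A → 𝔽, ∑ a, c a • m a t = x)
    (hli : ∀ t (c : A → 𝔽), (∀ a, c a ≠ 0 → t ∈ (I a).1) → ∑ a, c a • m a t = 0 → c = 0) :
    M.HasBarcode I := by
  classical
  have hbij : ∀ t, Function.Bijective (intervalSumMap (𝔽 := 𝔽) I t fun a => m a t) := by
    intro t
    constructor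
    · refine (injective_iff_map_eq_zero _).2 fun y hy => ?_
      rw [intervalSumMap_apply] at hy
      have h0 := hli t _ (fun a ha => by
        by_contra hta
        exact ha (by rw [intervalValue_eq_zero hta (y a)]; rfl)) hy
      exact DFinsupp.ext fun a => Subtype.ext (congrFun h0 a)
    · intro x
      obtain ⟨c, hc⟩ := hspan t x
      -- Coefficients on bars not containing `t` may be dropped, since the corresponding elements
      -- are zero there.
      let y : DirectSum A fun a => intervalValue 𝔽 (I a) t := DFinsupp.equivFunOnFintype.symm
        fun a => if h : t ∈ (I a).1 then ⟨c a, mem_intervalValue h _⟩ else 0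
      refine ⟨y, ?_⟩
      rw [intervalSumMap_apply, ← hc]
      refine Finset.sum_congr rfl fun a _ => ?_
      have hy : y a = if h : t ∈ (I a).1 then ⟨c a, mem_intervalValue h _⟩ else 0 := rfl
      by_cases h : t ∈ (I a).1
      · rw [hy, dif_pos h]
      · rw [hzero a t h, smul_zero, smul_zero]
  let E : ∀ t, (DirectSum A fun a => intervalValue 𝔽 (I a) t) ≃ₗ[𝔽] M.obj t := fun t =>
    LinearEquiv.ofBijective _ (hbij t)
  refine ⟨fun t => (E t).symm, fun s t g x => ?_⟩
  obtain ⟨y, rfl⟩ := (E s).surjective x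
  refine (LinearEquiv.symm_apply_eq (E t)).2 (Eq.trans ?_
    (congrArg (fun z => E t (((PersMod.directSum fun a => intervalModule 𝔽 (I a)).map g).hom z))
      ((E s).symm_apply_apply y).symm))
  have hl := intervalSumMap_apply I s (fun a => m a s) y
  have hr := intervalSumMap_apply I t (fun a => m a t)
    (((PersMod.directSum fun a => intervalModule 𝔽 (I a)).map g).hom y)
  refine Eq.trans (congrArg (M.map g).hom hl) (Eq.trans ?_ hr.symm)
  rw [map_sum]
  refine Finset.sum_congr rfl fun a _ => ?_
  rw [map_smul]
  have hy : DirectSum.component 𝔽 A (fun a => intervalValue 𝔽 (I a) t) a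
      (((PersMod.directSum fun a => intervalModule 𝔽 (I a)).map g).hom y) = intervalMap 𝔽 (I a) s t (y a) := rfl
  refine Eq.trans ?_ (congrArg (fun c : intervalValue 𝔽 (I a) t => (c : 𝔽) • m a t) hy.symm)
  by_cases hs : s ∈ (I a).1
  · rw [hmap a s t g hs]
    by_cases ht : t ∈ (I a).1
    · simp [intervalMap, hs, ht]
    · rw [hzero a t ht, smul_zero, smul_zero]
  · rw [intervalValue_eq_zero hs (y a)]
    simp

/-- Barcodes of the images of a family of morphisms combine to a barcode of the image of the direct
sum of the family. -/
theorem PersMod.HasBarcode.image_directSumMap {M M' : ℕ → PersMod.{v, w} 𝔽 N}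
    (η : ∀ d, M d ⟶ M' d) {A : Type} [Fintype A] (deg : A → ℕ) (I : A → TInterval N)
    (h : ∀ d, (PersMod.image (η d)).HasBarcode fun a : {a // deg a = d} => I a.1) :
    (PersMod.image (PersMod.directSumMap η)).HasBarcode I := by
  classical
  choose e he using h
  have hmem : ∀ t (x : (PersMod.image (PersMod.directSumMap η)).obj t) (d : ℕ),
      DirectSum.component 𝔽 ℕ (fun d => (M' d).obj t) d x.1 ∈ LinearMap.range ((η d).app t).hom := by
    rintro t ⟨_, z, rfl⟩ d
    exact ⟨DirectSum.component 𝔽 ℕ (fun d => (M d).obj t) d z, rfl⟩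
  let pr : ∀ t (d : ℕ), (PersMod.image (PersMod.directSumMap η)).obj t →ₗ[𝔽]
      (PersMod.image (η d)).obj t := fun t d =>
    LinearMap.codRestrict (LinearMap.range ((η d).app t).hom)
      ((DirectSum.component 𝔽 ℕ (fun d => (M' d).obj t) d).comp
        (LinearMap.range ((PersMod.directSumMap η).app t).hom).subtype) fun x => hmem t x d
  let Φ : ∀ t, (PersMod.image (PersMod.directSumMap η)).obj t →ₗ[𝔽]
      (DirectSum A fun a => intervalValue 𝔽 (I a) t) := fun t =>
    (DirectSum.linearEquivFunOnFintype 𝔽 A (fun a => intervalValue 𝔽 (I a) t)).symm.toLinearMap.comp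
      (LinearMap.pi fun a =>
        (DirectSum.component 𝔽 {a' // deg a' = deg a} (fun a' => intervalValue 𝔽 (I a'.1) t)
          ⟨a, rfl⟩).comp ((e (deg a) t).toLinearMap.comp (pr t (deg a))))
  have hΦ : ∀ t x a, Φ t x a = DirectSum.component 𝔽 {a' // deg a' = deg a}
      (fun a' => intervalValue 𝔽 (I a'.1) t) ⟨a, rfl⟩ (e (deg a) t (pr t (deg a) x)) :=
    fun t x a => rfl
  have hbij : ∀ t, Function.Bijective (Φ t) := by
    intro t
    constructor
    · refine (injective_iff_map_eq_zero _).2 fun x hx => ?_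
      refine Subtype.ext (DFinsupp.ext fun d => ?_)
      have h1 : e d t (pr t d x) = 0 := by
        refine DFinsupp.ext ?_
        rintro ⟨a, rfl⟩
        exact (hΦ t x a).symm.trans (congrArg (fun z => z a) hx)
      exact congrArg Subtype.val ((e d t).map_eq_zero_iff.1 h1)
    · intro y
      let z : ∀ d, (PersMod.image (η d)).obj t := fun d => (e d t).symm
        (DFinsupp.equivFunOnFintype.symm fun a : {a // deg a = d} => y a.1)
      choose w hw using fun d => (z d).2
      -- There is a preimage in every degree, but a direct sum allows only finitely many. The
      -- degrees of actual bars suffice for the components tested below.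
      let W : DirectSum ℕ fun d => (M d).obj t :=
        ∑ d ∈ Finset.univ.image deg, DirectSum.lof 𝔽 ℕ (fun d => (M d).obj t) d (w d)
      refine ⟨⟨((PersMod.directSumMap η).app t).hom W, W, rfl⟩, DFinsupp.ext fun a => ?_⟩
      refine (hΦ t _ a).trans ?_
      have hW : W (deg a) = w (deg a) := by
        change DirectSum.component 𝔽 ℕ (fun d => (M d).obj t) (deg a) W = _
        rw [map_sum, Finset.sum_eq_single (deg a)]
        · exact DirectSum.component.lof_self (M := fun d => (M d).obj t) 𝔽 (deg a) (w (deg a))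
        · exact fun d _ hd => (DirectSum.component.of 𝔽 _ _ _).trans (dif_neg hd)
        · exact fun hn => absurd (Finset.mem_image_of_mem deg (Finset.mem_univ a)) hn
      have h1 : pr t (deg a) ⟨((PersMod.directSumMap η).app t).hom W, W, rfl⟩ = z (deg a) := by
        refine Subtype.ext (Eq.trans ?_ (hw (deg a)))
        exact congrArg ((η (deg a)).app t).hom hW
      rw [h1]
      exact congrArg (fun z : DirectSum {a' // deg a' = deg a} fun a' =>
        intervalValue 𝔽 (I a'.1) t => z ⟨a, rfl⟩) ((e (deg a) t).apply_symm_apply _)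
  refine ⟨fun t => LinearEquiv.ofBijective (Φ t) (hbij t), fun s t g x => ?_⟩
  refine DFinsupp.ext fun a => ?_
  refine (hΦ t _ a).trans ?_
  have h1 := congrArg (fun z : DirectSum {a' // deg a' = deg a} fun a' =>
        intervalValue 𝔽 (I a'.1) t => z ⟨a, rfl⟩) (he (deg a) s t g (pr s (deg a) x))
  exact h1

end Barcodes

/-! ### Chains as vectors -/

section Chains

open scoped Matrix

variable {𝔽 : Type v} [Field 𝔽]

theorem boundary_single {V : Type u} [LinearOrder V] (s : Finset V) (hs : 2 ≤ s.card) (a : 𝔽) :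
    simplicialBoundary 𝔽 V (Finsupp.single s a) =
      ∑ x ∈ s, Finsupp.single (s.erase x) (a * (-1 : 𝔽) ^ (s.filter (· < x)).card) := by
  rw [simplicialBoundary, Finsupp.linearCombination_single, if_pos hs, Finset.smul_sum]
  simp only [Finsupp.smul_single, smul_eq_mul]

theorem boundary_single_of_card_lt {V : Type u} [LinearOrder V] (s : Finset V)
    (hs : s.card < 2) (a : 𝔽) : simplicialBoundary 𝔽 V (Finsupp.single s a) = 0 := by
  rw [simplicialBoundary, Finsupp.linearCombination_single, if_neg (not_le.2 hs), smul_zero]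

/-- Removing `x` then `y` cancels removing `y` then `x`: the sign for the smaller vertex is
unaffected by the order, while the sign for the larger one flips. -/
theorem boundary_boundary_single {V : Type u} [LinearOrder V] (s : Finset V) :
    simplicialBoundary 𝔽 V (simplicialBoundary 𝔽 V (Finsupp.single s 1)) = 0 := by
  rcases lt_or_ge s.card 2 with h | h
  · rw [boundary_single_of_card_lt s h, map_zero]
  rw [boundary_single s h, map_sum]
  -- For an edge there is nothing to cancel: the boundary is not augmented, so vertices have
  -- boundary zero.
  rcases h.eq_or_lt with h | h
  · refine Finset.sum_eq_zero fun x hx => boundary_single_of_card_lt _ ?_ _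
    rw [Finset.card_erase_of_mem hx]
    omega
  have h1 : ∀ x ∈ s, simplicialBoundary 𝔽 V
      (Finsupp.single (s.erase x) (1 * (-1 : 𝔽) ^ (s.filter (· < x)).card)) =
      ∑ y ∈ s.erase x, Finsupp.single ((s.erase x).erase y)
        ((-1 : 𝔽) ^ (s.filter (· < x)).card * (-1 : 𝔽) ^ ((s.erase x).filter (· < y)).card) := by
    intro x hx
    rw [boundary_single _ (by rw [Finset.card_erase_of_mem hx]; omega), one_mul]
  rw [Finset.sum_congr rfl h1, Finset.sum_sigma']
  refine Finset.sum_involution (fun p _ => ⟨p.2, p.1⟩) ?_ ?_ ?_ ?_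
  · rintro ⟨x, y⟩ hp
    simp only [Finset.mem_sigma, Finset.mem_erase] at hp
    obtain ⟨hx, hyx, hy⟩ := hp
    have key : ∀ a b : V, a ∈ s → b ∈ s → a < b →
        ((s.erase b).filter (· < a)).card = (s.filter (· < a)).card ∧
        ((s.erase a).filter (· < b)).card + 1 = (s.filter (· < b)).card := by
      intro a b ha hb hab
      rw [Finset.filter_erase, Finset.filter_erase]
      refine ⟨congrArg Finset.card (Finset.erase_eq_of_notMem fun h => ?_),
        Finset.card_erase_add_one (by simp [ha, hab])⟩
      exact hab.not_gt (Finset.mem_filter.1 h).2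
    simp only
    rw [Finset.erase_right_comm, ← Finsupp.single_add]
    refine Finsupp.single_eq_zero.2 ?_
    rcases lt_or_gt_of_ne hyx with hlt | hlt
    · obtain ⟨h2, h3⟩ := key y x hy hx hlt
      rw [h2, ← h3]; ring
    · obtain ⟨h2, h3⟩ := key x y hx hy hlt
      rw [h2, ← h3]; ring
  · rintro ⟨x, y⟩ hp _ he
    simp only [Finset.mem_sigma, Finset.mem_erase] at hp
    exact hp.2.1 (congrArg Sigma.fst he)
  · rintro ⟨x, y⟩ hp
    simp only [Finset.mem_sigma, Finset.mem_erase] at hp ⊢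
    exact ⟨hp.2.2, hp.2.1.symm, hp.1⟩
  · rintro ⟨x, y⟩ _
    rfl

theorem boundary_single_apply_ne_zero {V : Type u} [LinearOrder V] {s r : Finset V}
    (h : simplicialBoundary 𝔽 V (Finsupp.single s 1) r ≠ 0) :
    r ⊆ s ∧ r.Nonempty ∧ s.card = r.card + 1 := by
  rcases lt_or_ge s.card 2 with hs | hs
  · rw [boundary_single_of_card_lt s hs] at h
    exact absurd rfl h
  rw [boundary_single s hs, Finsupp.finsetSum_apply] at h
  obtain ⟨x, hx, hne⟩ := Finset.exists_ne_zero_of_sum_ne_zero h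
  obtain rfl : s.erase x = r := by
    by_contra hn
    exact hne (Finsupp.single_eq_of_ne (Ne.symm hn))
  have h1 := Finset.card_erase_add_one hx
  exact ⟨Finset.erase_subset _ _, Finset.card_pos.1 (by omega), h1.symm⟩

theorem chainMap_single {U V : Type u} [LinearOrder U] [LinearOrder V] (f : U → V) (s : Finset U) :
    chainMap 𝔽 f (Finsupp.single s 1) = Finsupp.single (s.image f) ((-1) ^ inversions f s) := by
  rw [chainMap, Finsupp.linearCombination_single, one_smul]

namespace SimplicialFiltration

variable {V : Type u} {N : ℕ} (F : SimplicialFiltration V N)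

theorem entry_le_iff (s : F.Simplex) (t : Fin (N + 1)) : F.entry s ≤ t ↔ s.1 ∈ F.complex t := by
  have hmem : F.entry s ∈ {t | s.1 ∈ F.complex t} := csInf_mem ⟨Fin.last N, s.2⟩
  exact ⟨fun h => F.mono h hmem, fun h => csInf_le (OrderBot.bddBelow _) h⟩

end SimplicialFiltration

namespace SimplexOrder

variable {U V : Type u} {N n : ℕ} {F : SimplicialFiltration V N} (e : SimplexOrder F n)

theorem revSimplex_bijective : Function.Bijective e.revSimplex :=
  e.simplex.bijective.comp Fin.rev_bijective

/-- Larger indices mean earlier simplices. A chain supported on indices `≥ c` is therefore present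
as soon as simplex `c` is. -/
theorem entry_revSimplex_antitone {i j : Fin n} (h : i ≤ j) :
    F.entry (e.revSimplex j) ≤ F.entry (e.revSimplex i) :=
  e.refines _ _ (Fin.rev_le_rev.2 h)

theorem card_revSimplex (i : Fin n) : (e.revSimplex i).1.card = e.revDim i + 1 := by
  have h : 0 < (e.revSimplex i).1.card := Finset.card_pos.2
    ((F.complex (Fin.last N)).isRelLowerSet_faces (e.revSimplex i).2).1
  unfold revDim
  omega

/-- The chain with given coefficients with respect to the simplices in reverse order. -/
noncomputable def toChain (e : SimplexOrder F n) : (Fin n → 𝔽) →ₗ[𝔽] (Finset V →₀ 𝔽) :=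
  Fintype.linearCombination 𝔽 fun i => Finsupp.single (e.revSimplex i).1 1

theorem toChain_eq_sum (x : Fin n → 𝔽) :
    e.toChain x = ∑ i, Finsupp.single (e.revSimplex i).1 (x i) := by
  simp [toChain, Fintype.linearCombination_apply]

theorem toChain_apply (x : Fin n → 𝔽) (i : Fin n) : e.toChain x (e.revSimplex i).1 = x i := by
  rw [toChain_eq_sum, Finsupp.finsetSum_apply, Finset.sum_eq_single i]
  · simp
  · intro j _ hj
    refine Finsupp.single_eq_of_ne fun h => hj ?_
    exact (e.revSimplex_bijective.1 (Subtype.ext h)).symm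
  · simp

theorem toChain_injective : Function.Injective (e.toChain (𝔽 := 𝔽)) := fun x y h =>
  funext fun i => by rw [← e.toChain_apply x, h, toChain_apply]

theorem toChain_apply_of_notMem (x : Fin n → 𝔽) (s : Finset V)
    (hs : s ∉ F.complex (Fin.last N)) : e.toChain x s = 0 := by
  rw [toChain_eq_sum, Finsupp.finsetSum_apply]
  exact Finset.sum_eq_zero fun j _ => Finsupp.single_eq_of_ne fun h => hs (h ▸ (e.revSimplex j).2)

theorem toChain_surjOn (c : Finset V →₀ 𝔽) (hc : ∀ s, c s ≠ 0 → s ∈ F.complex (Fin.last N)) :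
    e.toChain (fun i => c (e.revSimplex i).1) = c := by
  ext s
  by_cases hs : s ∈ F.complex (Fin.last N)
  · obtain ⟨i, hi⟩ := e.revSimplex_bijective.2 ⟨s, hs⟩
    obtain rfl : (e.revSimplex i).1 = s := congrArg Subtype.val hi
    exact e.toChain_apply _ i
  · rw [e.toChain_apply_of_notMem _ s hs]
    by_contra h
    exact hs (hc s (Ne.symm h))

theorem toChain_mem_chains_iff (x : Fin n → 𝔽) (d : ℕ) (t : Fin (N + 1)) :
    e.toChain x ∈ F.chains 𝔽 d t ↔
      ∀ i, x i ≠ 0 → F.entry (e.revSimplex i) ≤ t ∧ e.revDim i = d := by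
  rw [SimplicialFiltration.chains, Finsupp.mem_supported]
  constructor
  · intro h i hi
    obtain ⟨h1, h2⟩ := h (show (e.revSimplex i).1 ∈ (e.toChain x).support by
      rwa [Finsupp.mem_support_iff, toChain_apply])
    rw [card_revSimplex] at h2
    exact ⟨(F.entry_le_iff _ _).2 h1, Nat.succ_injective h2⟩
  · intro h s hs
    have hs' : e.toChain x s ≠ 0 := Finsupp.mem_support_iff.1 hs
    have hK : s ∈ F.complex (Fin.last N) := by
      by_contra hn
      exact hs' (e.toChain_apply_of_notMem x s hn)
    obtain ⟨i, hi⟩ := e.revSimplex_bijective.2 ⟨s, hK⟩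
    obtain rfl : (e.revSimplex i).1 = s := congrArg Subtype.val hi
    rw [toChain_apply] at hs'
    obtain ⟨h1, h2⟩ := h i hs'
    exact ⟨(F.entry_le_iff _ _).1 h1, by rw [card_revSimplex, h2]⟩

theorem exists_toChain_eq {d : ℕ} {t : Fin (N + 1)} {c : Finset V →₀ 𝔽}
    (hc : c ∈ F.chains 𝔽 d t) : ∃ x : Fin n → 𝔽, e.toChain x = c :=
  ⟨_, e.toChain_surjOn c fun _ hs =>
    F.mono (Fin.le_last t) ((Finsupp.mem_supported 𝔽 c).1 hc (Finsupp.mem_support_iff.2 hs)).1⟩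

/-- The matrix of a linear map of chains. -/
theorem map_toChain {L : SimplicialFiltration U N} (eL : SimplexOrder L n)
    (φ : (Finset U →₀ 𝔽) →ₗ[𝔽] (Finset V →₀ 𝔽)) (M : Matrix (Fin n) (Fin n) 𝔽)
    (hM : ∀ i j, M i j = φ (Finsupp.single (eL.revSimplex j).1 1) (e.revSimplex i).1)
    (hφ : ∀ j s, φ (Finsupp.single (eL.revSimplex j).1 1) s ≠ 0 → s ∈ F.complex (Fin.last N))
    (x : Fin n → 𝔽) : φ (eL.toChain x) = e.toChain (M.mulVec x) := by
  have h1 : M.mulVec x = ∑ j, x j • fun i => φ (Finsupp.single (eL.revSimplex j).1 1)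
      (e.revSimplex i).1 := by
    ext i
    simp [Matrix.mulVec, dotProduct, hM, mul_comm]
  rw [h1, map_sum, toChain, Fintype.linearCombination_apply, map_sum]
  refine Finset.sum_congr rfl fun j _ => ?_
  rw [map_smul, map_smul, ← e.toChain_surjOn _ (hφ j)]
  simp only [toChain_apply]

variable [LinearOrder V]

/-- Transposing along both diagonals reverses the order of rows and of columns. So the transpose of
`(D^L)^⊥` is the boundary matrix again, in the reversed order of simplices. -/
theorem boundary_toChain (x : Fin n → 𝔽) :
    simplicialBoundary 𝔽 V (e.toChain x) =
      e.toChain ((antiTranspose (e.boundaryMatrix 𝔽))ᵀ.mulVec x) := by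
  refine e.map_toChain e _ _ (fun i j => rfl) (fun j s hs => ?_) x
  obtain ⟨h1, h2, -⟩ := boundary_single_apply_ne_zero hs
  exact ((F.complex (Fin.last N)).isRelLowerSet_faces (e.revSimplex j).2).2 h1 h2

theorem revDim_of_boundaryMatrix_ne_zero {i j : Fin n}
    (h : antiTranspose (e.boundaryMatrix 𝔽) i j ≠ 0) : e.revDim i = e.revDim j + 1 := by
  have h1 := (boundary_single_apply_ne_zero (𝔽 := 𝔽) (s := (e.revSimplex i).1)
    (r := (e.revSimplex j).1) h).2.2
  rw [card_revSimplex, card_revSimplex] at h1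
  omega

theorem antiTranspose_boundaryMatrix_mul_self :
    antiTranspose (e.boundaryMatrix 𝔽) * antiTranspose (e.boundaryMatrix 𝔽) = 0 := by
  rw [← Matrix.transpose_eq_zero, Matrix.transpose_mul]
  refine Matrix.ext_of_mulVec_single fun j => e.toChain_injective ?_
  rw [← Matrix.mulVec_mulVec, ← boundary_toChain, ← boundary_toChain, Matrix.zero_mulVec, map_zero,
    toChain, Fintype.linearCombination_apply_single, one_smul, boundary_boundary_single]

end SimplexOrder

end Chains

/-! ### The matrices and the image homology of a monomorphism of filtrations -/

section MonomorphismMatrices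

open scoped Matrix

variable {𝔽 : Type v} [Field 𝔽] {n : ℕ}

/-- The projection `Z → Z / (Z ∩ B)`. -/
noncomputable def subquotientMk {X : Type w} [AddCommGroup X] [Module 𝔽 X]
    (Z B : Submodule 𝔽 X) : Z →ₗ[𝔽] Subquotient Z B :=
  (B.submoduleOf Z).mkQ

theorem subquotientMk_surjective {X : Type w} [AddCommGroup X] [Module 𝔽 X]
    (Z B : Submodule 𝔽 X) : Function.Surjective (subquotientMk Z B) :=
  Submodule.mkQ_surjective _

theorem subquotientMk_eq_zero_iff {X : Type w} [AddCommGroup X] [Module 𝔽 X]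
    (Z B : Submodule 𝔽 X) (x : Z) : subquotientMk Z B x = 0 ↔ x.1 ∈ B :=
  Submodule.Quotient.mk_eq_zero _

theorem antiTranspose_mul (X Y : Matrix (Fin n) (Fin n) 𝔽) :
    antiTranspose (X * Y) = antiTranspose Y * antiTranspose X := by
  ext i j
  simp only [antiTranspose, Matrix.of_apply, Matrix.mul_apply]
  rw [← Equiv.sum_comp Fin.revPerm]
  exact Finset.sum_congr rfl fun k _ => by simp [mul_comm]

theorem antiTranspose_one : antiTranspose (1 : Matrix (Fin n) (Fin n) 𝔽) = 1 := by
  ext i j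
  simp [antiTranspose, Matrix.one_apply, Fin.rev_inj, eq_comm]

namespace FiltrationMono

variable {U V : Type u} [LinearOrder U] [LinearOrder V] {N : ℕ}
  {L : SimplicialFiltration U N} {K : SimplicialFiltration V N} (f : FiltrationMono L K)
  (eL : SimplexOrder L n) (eK : SimplexOrder K n)

omit [LinearOrder U] in
include f in
theorem image_mem {s : Finset U} (hs : s ∈ L.complex (Fin.last N)) :
    s.image f.toFun ∈ K.complex (Fin.last N) :=
  f.map_le _ (Set.mem_image_of_mem _ hs)

omit [LinearOrder U] in
theorem image_injOn {s r : Finset U} (hs : s ∈ L.complex (Fin.last N))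
    (hr : r ∈ L.complex (Fin.last N)) (h : s.image f.toFun = r.image f.toFun) : s = r := by
  have hv : ∀ {s : Finset U}, s ∈ L.complex (Fin.last N) →
      (s : Set U) ⊆ {x | {x} ∈ L.complex (Fin.last N)} := fun {s} hs x hx =>
    ((L.complex (Fin.last N)).isRelLowerSet_faces hs).2
      (Finset.singleton_subset_iff.2 hx) (Finset.singleton_nonempty x)
  have h1 : f.toFun '' s = f.toFun '' r := by
    rw [← Finset.coe_image, ← Finset.coe_image, h]
  exact Finset.coe_injective ((f.injOn.image_eq_image_iff (hv hs) (hv hr)).1 h1)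

theorem chainMatrix_apply (i j : Fin n) :
    f.chainMatrix 𝔽 eL eK i j = Finsupp.single ((eL.simplex j).1.image f.toFun)
      ((-1 : 𝔽) ^ inversions f.toFun (eL.simplex j).1) (eK.simplex i).1 := by
  rw [chainMatrix, Matrix.of_apply, chainMap_single]

/-- `F` is a signed permutation matrix, because `f` is injective on simplices; hence it is
orthogonal. -/
theorem chainMatrix_transpose_mul :
    (f.chainMatrix 𝔽 eL eK)ᵀ * f.chainMatrix 𝔽 eL eK = 1 := by
  ext i j
  rw [Matrix.mul_apply]
  simp only [Matrix.transpose_apply, chainMatrix_apply]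
  by_cases hij : i = j
  · subst hij
    obtain ⟨k, hk⟩ := eK.simplex.surjective ⟨_, f.image_mem (eL.simplex i).2⟩
    rw [Matrix.one_apply_eq, Finset.sum_eq_single k]
    · rw [hk, Finsupp.single_eq_same, ← pow_add, ← two_mul, pow_mul]
      simp
    · intro l _ hl
      rw [Finsupp.single_eq_of_ne, zero_mul]
      intro h
      exact hl (eK.simplex.injective ((Subtype.ext h).trans hk.symm))
    · simp
  · rw [Matrix.one_apply_ne hij]
    refine Finset.sum_eq_zero fun k _ => ?_
    by_contra h
    have h1 := left_ne_zero_of_mul h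
    have h2 := right_ne_zero_of_mul h
    rw [Finsupp.single_apply_ne_zero] at h1 h2
    exact hij (eL.simplex.injective (Subtype.ext
      (f.image_injOn (eL.simplex i).2 (eL.simplex j).2 (h1.1.symm.trans h2.1))))

theorem chainMatrix_inv : (f.chainMatrix 𝔽 eL eK)⁻¹ = (f.chainMatrix 𝔽 eL eK)ᵀ :=
  Matrix.inv_eq_left_inv (f.chainMatrix_transpose_mul eL eK)

theorem antiTranspose_mixedMatrix :
    antiTranspose (f.mixedMatrix 𝔽 eL eK) =
      antiTranspose ((f.chainMatrix 𝔽 eL eK)⁻¹) * antiTranspose (eL.boundaryMatrix 𝔽) :=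
  antiTranspose_mul _ _

theorem antiTranspose_chainMatrix_mul_inv :
    antiTranspose (f.chainMatrix 𝔽 eL eK) * antiTranspose ((f.chainMatrix 𝔽 eL eK)⁻¹) = 1 := by
  rw [← antiTranspose_mul, chainMatrix_inv, chainMatrix_transpose_mul, antiTranspose_one]

theorem isUnit_antiTranspose_chainMatrix_inv :
    IsUnit (antiTranspose ((f.chainMatrix 𝔽 eL eK)⁻¹)) :=
  IsUnit.of_mul_eq_one_right _ (f.antiTranspose_chainMatrix_mul_inv eL eK)

theorem antiTranspose_chainMatrix_mul_mixedMatrix :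
    antiTranspose (f.chainMatrix 𝔽 eL eK) * antiTranspose (f.mixedMatrix 𝔽 eL eK) =
      antiTranspose (eL.boundaryMatrix 𝔽) := by
  rw [antiTranspose_mixedMatrix, ← Matrix.mul_assoc, antiTranspose_chainMatrix_mul_inv,
    Matrix.one_mul]

theorem revDim_of_mixedMatrix_ne_zero {i j : Fin n}
    (h : antiTranspose (f.mixedMatrix 𝔽 eL eK) i j ≠ 0) : eK.revDim i = eL.revDim j + 1 := by
  rw [antiTranspose_mixedMatrix] at h
  obtain ⟨k, -, hk⟩ := Finset.exists_ne_zero_of_sum_ne_zero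
    (show ∑ k, antiTranspose ((f.chainMatrix 𝔽 eL eK)⁻¹) i k *
      antiTranspose (eL.boundaryMatrix 𝔽) k j ≠ 0 by rwa [Matrix.mul_apply] at h)
  rw [← eL.revDim_of_boundaryMatrix_ne_zero (right_ne_zero_of_mul hk)]
  have h1 := left_ne_zero_of_mul hk
  rw [chainMatrix_inv, antiTranspose, Matrix.of_apply, Matrix.transpose_apply, chainMatrix_apply,
    Finsupp.single_apply_ne_zero] at h1
  have h2 : (eK.revSimplex i).1.card = (eL.revSimplex k).1.card := by
    rw [SimplexOrder.revSimplex, h1.1, Finset.card_image_of_injOn (f.injOn_face (eL.simplex _).2)]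
    rfl
  rw [SimplexOrder.revDim, SimplexOrder.revDim, h2]

theorem chainMap_toChain (x : Fin n → 𝔽) :
    chainMap 𝔽 f.toFun (eL.toChain x) =
      eK.toChain ((antiTranspose (f.chainMatrix 𝔽 eL eK))ᵀ.mulVec x) := by
  refine eK.map_toChain eL _ _ (fun i j => rfl) (fun j s hs => ?_) x
  rw [chainMap_single, Finsupp.single_apply_ne_zero] at hs
  rw [hs.1]
  exact f.image_mem (eL.revSimplex j).2

theorem boundary_chainMap_toChain (x : Fin n → 𝔽) :
    simplicialBoundary 𝔽 V (chainMap 𝔽 f.toFun (eL.toChain x)) =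
      chainMap 𝔽 f.toFun (simplicialBoundary 𝔽 U (eL.toChain x)) := by
  simp only [SimplexOrder.toChain, Fintype.linearCombination_apply, map_sum, map_smul]
  refine Finset.sum_congr rfl fun i _ => ?_
  rw [chainMap_boundary_single 𝔽 f.toFun _ (f.injOn_face (eL.revSimplex i).2)]

/-- The boundary operator of `K` in terms of the mixed boundary matrix. -/
theorem boundary_toChain_eq_chainMap (x : Fin n → 𝔽) :
    simplicialBoundary 𝔽 V (eK.toChain x) = chainMap 𝔽 f.toFun
      (eL.toChain ((antiTranspose (f.mixedMatrix 𝔽 eL eK))ᵀ.mulVec x)) := by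
  -- Every chain of `K` is the image of a chain of `L`, obtained through `F⁻¹`; its boundary can be
  -- taken in `L`.
  have h1 : eK.toChain x = chainMap 𝔽 f.toFun
      (eL.toChain ((antiTranspose ((f.chainMatrix 𝔽 eL eK)⁻¹))ᵀ.mulVec x)) := by
    rw [f.chainMap_toChain eL eK, Matrix.mulVec_mulVec, ← Matrix.transpose_mul,
      mul_eq_one_comm.1 (f.antiTranspose_chainMatrix_mul_inv eL eK), Matrix.transpose_one,
      Matrix.one_mulVec]
  rw [h1, f.boundary_chainMap_toChain, eL.boundary_toChain, Matrix.mulVec_mulVec,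
    ← Matrix.transpose_mul, antiTranspose_mixedMatrix]

include eK in
theorem chainMap_toChain_injective :
    Function.Injective fun x : Fin n → 𝔽 => chainMap 𝔽 f.toFun (eL.toChain x) := by
  intro x y h
  simp only [f.chainMap_toChain eL eK] at h
  have h1 := congrArg (antiTranspose ((f.chainMatrix 𝔽 eL eK)⁻¹))ᵀ.mulVec (eK.toChain_injective h)
  simpa only [Matrix.mulVec_mulVec, ← Matrix.transpose_mul, antiTranspose_chainMatrix_mul_inv,
    Matrix.transpose_one, Matrix.one_mulVec] using h1

/-! ### The image of the map in homology -/

/-- The vectors that represent `d`-cycles of `L_t`. -/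
noncomputable def cycleVectors (𝔽 : Type v) [Field 𝔽] (eL : SimplexOrder L n) (d : ℕ)
    (t : Fin (N + 1)) : Submodule 𝔽 (Fin n → 𝔽) :=
  (L.cycles 𝔽 d t).comap eL.toChain

theorem mem_cycleVectors_iff {d : ℕ} {t : Fin (N + 1)} {x : Fin n → 𝔽} :
    x ∈ cycleVectors 𝔽 eL d t ↔
      (∀ i, x i ≠ 0 → L.entry (eL.revSimplex i) ≤ t ∧ eL.revDim i = d) ∧
        (antiTranspose (eL.boundaryMatrix 𝔽))ᵀ.mulVec x = 0 := by
  rw [cycleVectors, Submodule.mem_comap, SimplicialFiltration.cycles, Submodule.mem_inf,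
    eL.toChain_mem_chains_iff, LinearMap.mem_ker, eL.boundary_toChain]
  exact and_congr_right fun _ => ⟨fun h => eL.toChain_injective (h.trans (map_zero _).symm),
    fun h => by rw [h, map_zero]⟩

/-- The class in `H_d(L_t)` of a vector that represents a cycle of `L_t`. -/
noncomputable def cycleClass (𝔽 : Type v) [Field 𝔽] (eL : SimplexOrder L n) (d : ℕ)
    (t : Fin (N + 1)) :
    cycleVectors 𝔽 eL d t →ₗ[𝔽] Subquotient (L.cycles 𝔽 d t) (L.boundaries 𝔽 d t) :=
  (subquotientMk (L.cycles 𝔽 d t) (L.boundaries 𝔽 d t)).comp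
    (eL.toChain.restrict (p := cycleVectors 𝔽 eL d t) (q := L.cycles 𝔽 d t) fun _ hx => hx)

theorem cycleClass_surjective (d : ℕ) (t : Fin (N + 1)) :
    Function.Surjective (cycleClass 𝔽 eL d t) := by
  refine (subquotientMk_surjective _ _).comp ?_
  rintro ⟨c, hc⟩
  obtain ⟨x, rfl⟩ := eL.exists_toChain_eq hc.1
  exact ⟨⟨x, hc⟩, rfl⟩

/-- The class in `im H_d(f_t)` of a vector that represents a cycle of `L_t`. -/
noncomputable def imageClass (f : FiltrationMono L K) (𝔽 : Type v) [Field 𝔽]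
    (eL : SimplexOrder L n) (d : ℕ) (t : Fin (N + 1)) :
    cycleVectors 𝔽 eL d t →ₗ[𝔽] (PersMod.image (f.homologyMap 𝔽 d)).obj t :=
  (LinearMap.rangeRestrict ((f.homologyMap 𝔽 d).app t).hom).comp (cycleClass 𝔽 eL d t)

theorem imageClass_surjective (d : ℕ) (t : Fin (N + 1)) :
    Function.Surjective (f.imageClass 𝔽 eL d t) :=
  (LinearMap.surjective_rangeRestrict ((f.homologyMap 𝔽 d).app t).hom).comp
    (cycleClass_surjective eL d t)

theorem map_imageClass (d : ℕ) {s t : Fin (N + 1)} (g : s ⟶ t) (x : Fin n → 𝔽)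
    (hs : x ∈ cycleVectors 𝔽 eL d s) (ht : x ∈ cycleVectors 𝔽 eL d t) :
    ((PersMod.image (f.homologyMap 𝔽 d)).map g).hom (f.imageClass 𝔽 eL d s ⟨x, hs⟩) =
      f.imageClass 𝔽 eL d t ⟨x, ht⟩ := rfl

/-- The class vanishes iff `f(x)` bounds in `K_t`. A boundary in `K` is `f` of the mixed matrix
applied to `y`, and injectivity of `f` on chains removes `f` from the equation. -/
theorem imageClass_eq_zero_iff (d : ℕ) (t : Fin (N + 1)) (x : cycleVectors 𝔽 eL d t) :
    f.imageClass 𝔽 eL d t x = 0 ↔ ∃ y : Fin n → 𝔽,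
      (∀ i, y i ≠ 0 → K.entry (eK.revSimplex i) ≤ t ∧ eK.revDim i = d + 1) ∧
        (antiTranspose (f.mixedMatrix 𝔽 eL eK))ᵀ.mulVec y = x.1 := by
  have h1 : f.imageClass 𝔽 eL d t x = 0 ↔
      chainMap 𝔽 f.toFun (eL.toChain x.1) ∈ K.boundaries 𝔽 d t :=
    Subtype.ext_iff.trans (subquotientMk_eq_zero_iff (K.cycles 𝔽 d t) (K.boundaries 𝔽 d t) _)
  rw [h1, SimplicialFiltration.boundaries]
  constructor
  · rintro ⟨c, hc, he⟩
    obtain ⟨y, rfl⟩ := eK.exists_toChain_eq hc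
    refine ⟨y, (eK.toChain_mem_chains_iff y _ _).1 hc, ?_⟩
    rw [f.boundary_toChain_eq_chainMap eL eK] at he
    exact f.chainMap_toChain_injective eL eK he
  · rintro ⟨y, hy, he⟩
    refine ⟨eK.toChain y, (eK.toChain_mem_chains_iff y _ _).2 hy, ?_⟩
    rw [f.boundary_toChain_eq_chainMap eL eK, he]

end FiltrationMono

end MonomorphismMatrices

/-! ### The image barcode -/

section ImageBarcodeProof

open scoped Matrix

variable {𝔽 : Type v} [Field 𝔽] {n : ℕ}

/-- Transposed matrices that shift degrees by one are compatible with the projections to the parts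
of a fixed degree. -/
theorem transpose_mulVec_degree_part {degL degK : Fin n → ℕ} {M : Matrix (Fin n) (Fin n) 𝔽}
    (hM : ∀ i j, M i j ≠ 0 → degK i = degL j + 1) (d : ℕ) (x : Fin n → 𝔽) (j : Fin n) :
    Mᵀ.mulVec (fun i => if degK i = d then x i else 0) j =
      if degL j + 1 = d then Mᵀ.mulVec x j else 0 := by
  change ∑ i, M i j * (if degK i = d then x i else 0) =
    if degL j + 1 = d then ∑ i, M i j * x i else 0
  by_cases hd : degL j + 1 = d
  · rw [if_pos hd]
    refine Finset.sum_congr rfl fun i _ => ?_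
    by_cases h : M i j = 0
    · rw [h, zero_mul, zero_mul]
    · rw [if_pos ((hM i j h).trans hd)]
  · rw [if_neg hd]
    refine Finset.sum_eq_zero fun i _ => ?_
    by_cases h : M i j = 0
    · rw [h, zero_mul]
    · rw [if_neg fun e => hd ((hM i j h).symm.trans e), mul_zero]

namespace FiltrationMono

variable {U V : Type u} [LinearOrder U] [LinearOrder V] {N : ℕ}
  {L : SimplicialFiltration U N} {K : SimplicialFiltration V N} (f : FiltrationMono L K)
  {eL : SimplexOrder L n} {eK : SimplexOrder K n}
  (S : Reduction (antiTranspose (f.mixedMatrix 𝔽 eL eK)))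
  (R : Reduction (antiTranspose (eL.boundaryMatrix 𝔽)))

theorem mixedMatrix_mul_boundaryMatrix :
    antiTranspose (f.mixedMatrix 𝔽 eL eK) * antiTranspose (eL.boundaryMatrix 𝔽) = 0 := by
  rw [antiTranspose_mixedMatrix, Matrix.mul_assoc, eL.antiTranspose_boundaryMatrix_mul_self,
    Matrix.mul_zero]

include f S R in
-- The two matrices have the same kernel, being related by an invertible left factor, and the kernel
-- alone determines which columns reduce to zero.
theorem col_eq_zero_iff (j : Fin n) : S.R.col j = 0 ↔ R.R.col j = 0 := by
  rw [S.col_eq_zero_iff, R.col_eq_zero_iff]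
  refine exists_congr fun w => and_congr_right fun _ => and_congr_right fun _ => ?_
  constructor
  · intro h
    rw [← f.antiTranspose_chainMatrix_mul_mixedMatrix eL eK, ← Matrix.mulVec_mulVec, h,
      Matrix.mulVec_zero]
  · intro h
    rw [antiTranspose_mixedMatrix, ← Matrix.mulVec_mulVec, h, Matrix.mulVec_zero]

include f S R in
-- Such a `j` is the leading index of some `f⁻¹(∂x)`, which is a cycle of `L`.
theorem notMem_pivs_of_col_ne_zero (j : Fin n) (h : S.R.col j ≠ 0) : j ∉ pivs R.R := by
  obtain ⟨x, -, h0, hj⟩ := S.exists_image_of_col_ne_zero j h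
  refine R.notMem_pivs_of_ker _ j hj h0 ?_
  rw [Matrix.mulVec_mulVec, ← Matrix.transpose_mul, mixedMatrix_mul_boundaryMatrix,
    Matrix.transpose_zero, Matrix.zero_mulVec]

include f S R in
/-- Homogeneous cycles with prescribed leading simplex that bound as early as possible in `K`. -/
theorem exists_adapted_cycle (c : Fin n) (hc : c ∉ pivs R.R) :
    ∃ z : Fin n → 𝔽, z c ≠ 0 ∧ (∀ i < c, z i = 0) ∧ (∀ i, z i ≠ 0 → eL.revDim i = eL.revDim c) ∧
      (antiTranspose (eL.boundaryMatrix 𝔽))ᵀ.mulVec z = 0 ∧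
      ∀ h : S.R.col c ≠ 0, ∃ x : Fin n → 𝔽,
        (∀ i, x i ≠ 0 → piv (S.R.col c) h ≤ i ∧ eK.revDim i = eL.revDim c + 1) ∧
          (antiTranspose (f.mixedMatrix 𝔽 eL eK))ᵀ.mulVec x = z := by
  by_cases h : S.R.col c = 0
  · obtain ⟨z, hzc, hz0, hz⟩ := R.exists_ker_of_notMem_pivs c hc
    refine ⟨fun i => if eL.revDim i = eL.revDim c then z i else 0, by simpa using hzc,
      fun i hi => by simp [hz0 i hi], fun i hi => ?_, ?_, fun h' => absurd h h'⟩
    · by_contra hne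
      simp [hne] at hi
    · ext j
      rw [transpose_mulVec_degree_part
        (fun i j hij => eL.revDim_of_boundaryMatrix_ne_zero hij), hz]
      simp
  · obtain ⟨x, hx0, hz0, hzc⟩ := S.exists_image_of_col_ne_zero c h
    -- Keeping only the part of degree one above `c` makes the cycle homogeneous without losing its
    -- leading entry or enlarging the support.
    set x' : Fin n → 𝔽 := fun i => if eK.revDim i = eL.revDim c + 1 then x i else 0 with hx'
    have key := transpose_mulVec_degree_part
      (fun i j hij => f.revDim_of_mixedMatrix_ne_zero (𝔽 := 𝔽) eL eK (i := i) (j := j) hij)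
      (eL.revDim c + 1) x
    refine ⟨(antiTranspose (f.mixedMatrix 𝔽 eL eK))ᵀ.mulVec x', ?_, fun i hi => ?_, fun i hi => ?_,
      ?_, fun _ => ⟨x', fun i hi => ?_, rfl⟩⟩
    · rw [key c, if_pos rfl]
      exact hzc
    · rw [key i, hz0 i hi, ite_self]
    · by_contra hne
      rw [key i, if_neg (by omega)] at hi
      exact hi rfl
    · rw [Matrix.mulVec_mulVec, ← Matrix.transpose_mul, mixedMatrix_mul_boundaryMatrix,
        Matrix.transpose_zero, Matrix.zero_mulVec]
    · by_cases hd : eK.revDim i = eL.revDim c + 1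
      · refine ⟨not_lt.1 fun hlt => hi ?_, hd⟩
        simp [hx', hx0 i hlt]
      · simp [hx', hd] at hi

/-- The barcode of `im H_d(f_•)`, with an arbitrary index type for the bars that is compared with
the indices of columns. -/
theorem hasBarcode_image_homologyMap (d : ℕ) {A : Type} [Fintype A] (idx : A → Fin n)
    (hidx : Function.Injective idx) (I : A → TInterval N)
    (hA : ∀ a, idx a ∉ pivs R.R ∧ eL.revDim (idx a) = d)
    (hI : ∀ a t, t ∈ (I a).1 ↔ L.entry (eL.revSimplex (idx a)) ≤ t ∧
      ∀ h : S.R.col (idx a) ≠ 0, t < K.entry (eK.revSimplex (piv _ h)))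
    (hcov : ∀ c, c ∉ pivs R.R → eL.revDim c = d → ∀ t, L.entry (eL.revSimplex c) ≤ t →
      (∀ h : S.R.col c ≠ 0, t < K.entry (eK.revSimplex (piv _ h))) → ∃ a, idx a = c) :
    (PersMod.image (f.homologyMap 𝔽 d)).HasBarcode I := by
  classical
  choose! z hzc hz0 hzdeg hzker hzx using fun c hc => f.exists_adapted_cycle S R c hc
  have hmem : ∀ c, c ∉ pivs R.R → eL.revDim c = d → ∀ t, L.entry (eL.revSimplex c) ≤ t →
      z c ∈ cycleVectors 𝔽 eL d t := by
    intro c hc hcd t ht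
    refine (mem_cycleVectors_iff eL).2 ⟨fun i hi => ⟨?_, (hzdeg c hc i hi).trans hcd⟩, hzker c hc⟩
    refine (eL.entry_revSimplex_antitone (not_lt.1 fun hlt => hi ?_)).trans ht
    exact hz0 c hc i hlt
  have hzero : ∀ c (hc : c ∉ pivs R.R) (hcd : eL.revDim c = d) t
      (ht : L.entry (eL.revSimplex c) ≤ t) (h : S.R.col c ≠ 0),
      K.entry (eK.revSimplex (piv _ h)) ≤ t →
        f.imageClass 𝔽 eL d t ⟨z c, hmem c hc hcd t ht⟩ = 0 := by
    intro c hc hcd t ht h hle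
    obtain ⟨x, hx, hxz⟩ := hzx c hc h
    refine (f.imageClass_eq_zero_iff eL eK d t _).2 ⟨x, fun i hi => ⟨?_, ?_⟩, hxz⟩
    · exact (eK.entry_revSimplex_antitone (hx i hi).1).trans hle
    · rw [(hx i hi).2, hcd]
  let ζ : ∀ (_ : A) t, cycleVectors 𝔽 eL d t := fun a t => if h : t ∈ (I a).1 then
    ⟨z (idx a), hmem _ (hA a).1 (hA a).2 t ((hI a t).1 h).1⟩ else 0
  have hζ : ∀ a t (h : t ∈ (I a).1),
      ζ a t = ⟨z (idx a), hmem _ (hA a).1 (hA a).2 t ((hI a t).1 h).1⟩ := fun a t h => dif_pos h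
  refine PersMod.HasBarcode.of_basis I (fun a t => f.imageClass 𝔽 eL d t (ζ a t)) ?_ ?_ ?_ ?_
  · intro a t ht
    rw [show ζ a t = 0 from dif_neg ht, map_zero]
  · intro a s t g hs
    have hst : s ≤ t := leOfHom g
    have hat := ((hI a s).1 hs).1.trans hst
    rw [hζ a s hs, f.map_imageClass eL d g _ _ (hmem _ (hA a).1 (hA a).2 t hat)]
    by_cases ht : t ∈ (I a).1
    · rw [hζ a t ht]
    · rw [show ζ a t = 0 from dif_neg ht, map_zero]
      -- Having been alive at `s ≤ t`, the bar can miss `t` only because it has ended, so the cycle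
      -- now bounds in `K_t`.
      have hex : ∃ h : S.R.col (idx a) ≠ 0, K.entry (eK.revSimplex (piv _ h)) ≤ t := by
        by_contra hn
        push Not at hn
        exact ht ((hI a t).2 ⟨hat, hn⟩)
      obtain ⟨h, hle⟩ := hex
      exact hzero _ (hA a).1 (hA a).2 t hat h hle
  · intro t x
    rw [← Submodule.mem_span_range_iff_exists_fun]
    obtain ⟨y, rfl⟩ := f.imageClass_surjective eL d t x
    -- Elimination of leading entries: `k` counts the last indices on which `y` may be supported.
    -- Subtracting a multiple of `z c`, with `c` the first of them, shrinks this range.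
    have key : ∀ (k : ℕ) (y : cycleVectors 𝔽 eL d t), (∀ i, y.1 i ≠ 0 → n ≤ i + k) →
        f.imageClass 𝔽 eL d t y ∈
          Submodule.span 𝔽 (Set.range fun a => f.imageClass 𝔽 eL d t (ζ a t)) := by
      intro k
      induction k with
      | zero =>
        intro y hy
        have hy0 : y = 0 := Subtype.ext (funext fun i => by
          by_contra hne
          exact absurd (hy i hne) (by omega))
        rw [hy0, map_zero]
        exact Submodule.zero_mem _
      | succ k ih =>
        intro y hy
        by_cases hex : ∃ c : Fin n, n = c + (k + 1) ∧ y.1 c ≠ 0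
        · obtain ⟨c, hck, hyc⟩ := hex
          obtain ⟨hysupp, hyker⟩ := (mem_cycleVectors_iff eL).1 y.2
          have hy0 : ∀ i < c, y.1 i = 0 := fun i hi => by
            by_contra hne
            have := hy i hne
            rw [Fin.lt_def] at hi
            omega
          have hc := R.notMem_pivs_of_ker y.1 c hyc hy0 hyker
          obtain ⟨hct, hcd⟩ := hysupp c hyc
          set zc : cycleVectors 𝔽 eL d t := ⟨z c, hmem c hc hcd t hct⟩ with hzcdef
          have hrec := ih (y - (y.1 c / z c c) • zc) fun i hi => by
            have hi' : y.1 i - y.1 c / z c c * z c i ≠ 0 := hi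
            by_contra hlt
            rcases lt_trichotomy i c with h | rfl | h
            · exact hi' (by rw [hy0 i h, hz0 c hc i h, mul_zero, sub_zero])
            · exact hi' (by rw [div_mul_cancel₀ _ (hzc i hc), sub_self])
            · rw [Fin.lt_def] at h
              omega
          have hzcmem : f.imageClass 𝔽 eL d t zc ∈
              Submodule.span 𝔽 (Set.range fun a => f.imageClass 𝔽 eL d t (ζ a t)) := by
            -- A cycle alive at `t` belongs to some bar by `hcov`; one that already bounds has class
            -- zero. Hence empty bars may be left out of the index type.
            by_cases hall : ∀ h : S.R.col c ≠ 0, t < K.entry (eK.revSimplex (piv _ h))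
            · obtain ⟨a, rfl⟩ := hcov c hc hcd t hct hall
              refine Submodule.subset_span ⟨a, ?_⟩
              simp only
              rw [hζ a t ((hI a t).2 ⟨hct, hall⟩)]
            · push Not at hall
              obtain ⟨h, hle⟩ := hall
              rw [hzcdef, hzero c hc hcd t hct h hle]
              exact Submodule.zero_mem _
          rw [map_sub, map_smul] at hrec
          simpa using Submodule.add_mem _ hrec (Submodule.smul_mem _ (y.1 c / z c c) hzcmem)
        · refine ih y fun i hi => ?_
          have h1 := hy i hi
          by_contra hlt
          exact hex ⟨i, by omega, hi⟩
    exact key n y fun i _ => Nat.le_add_left _ _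
  · intro t c hc h0
    by_contra hne
    obtain ⟨a₁, ha₁⟩ := Function.ne_iff.1 hne
    -- The smallest index in a vanishing combination is its leading index, as distinct bars start at
    -- distinct indices. Any chain of `K` it bounds then contains a simplex no earlier than the end
    -- of bar `a`, contradicting that this bar contains `t`.
    obtain ⟨a, ham, hmin⟩ := Finset.exists_min_image (Finset.univ.filter fun a => c a ≠ 0) idx
      ⟨a₁, by simpa using ha₁⟩
    have hca : c a ≠ 0 := by simpa using ham
    have hsum : f.imageClass 𝔽 eL d t (∑ a, c a • ζ a t) = 0 := by
      rw [map_sum, ← h0]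
      exact Finset.sum_congr rfl fun a _ => map_smul _ _ _
    obtain ⟨y, hy, hyz⟩ := (f.imageClass_eq_zero_iff eL eK d t _).1 hsum
    have hval : ∀ i, (∑ a, c a • ζ a t).1 i = ∑ a, c a * z (idx a) i := by
      intro i
      rw [Submodule.coe_sum, Finset.sum_apply]
      refine Finset.sum_congr rfl fun b _ => ?_
      by_cases hcb : c b = 0
      · simp [hcb]
      · rw [hζ b t (hc b hcb)]
        rfl
    have hlow : ∀ b, b ≠ a → ∀ i ≤ idx a, c b * z (idx b) i = 0 := by
      intro b hb i hi
      by_cases hcb : c b = 0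
      · rw [hcb, zero_mul]
      · have hlt : idx a < idx b :=
          lt_of_le_of_ne (hmin b (by simpa using hcb)) fun e => hb (hidx e.symm)
        rw [hz0 _ (hA b).1 i (hi.trans_lt hlt), mul_zero]
    have hval' : ∀ i ≤ idx a, (∑ a, c a • ζ a t).1 i = c a * z (idx a) i := fun i hi => by
      rw [hval, Finset.sum_eq_single a (fun b _ hb => hlow b hb i hi) (by simp)]
    obtain ⟨h, i, hi, hyi⟩ := S.exists_le_piv y (idx a)
      (fun i hi => by rw [hyz, hval' i hi.le, hz0 _ (hA a).1 i hi, mul_zero])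
      (by rw [hyz, hval' _ le_rfl]; exact mul_ne_zero hca (hzc _ (hA a).1))
    exact absurd (((hI a t).1 (hc a hca)).2 h)
      (not_lt.2 ((eK.entry_revSimplex_antitone hi).trans (hy i hyi).1))

end FiltrationMono

end ImageBarcodeProof

/-! ### Bars expressed through column indices -/

section Bars

variable {𝔽 : Type v} [Field 𝔽] {U V : Type u} {N n : ℕ} {L : SimplicialFiltration U N}
  {K : SimplicialFiltration V N} {eL : SimplexOrder L n} {eK : SimplexOrder K n}
  {D : Matrix (Fin n) (Fin n) 𝔽} (ρ : Reduction D)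

namespace Reduction

theorem pivSimp_V_col (j : Fin n) :
    eL.pivSimp (ρ.V.col j) (ρ.V_col_ne_zero j) = eL.revSimplex j := by
  rw [SimplexOrder.pivSimp, ρ.piv_V_col]

theorem card_pivSimp_V_col_iff (j : Fin n) (d : ℕ) :
    (eL.pivSimp (ρ.V.col j) (ρ.V_col_ne_zero j)).1.card = d + 1 ↔ eL.revDim j = d := by
  rw [pivSimp_V_col, eL.card_revSimplex, Nat.add_right_cancel_iff]

theorem mem_finiteBar_iff (j : {j : Fin n // ρ.R.col j ≠ 0}) (t : Fin (N + 1)) :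
    t ∈ (finiteBar eL eK ρ j).1 ↔ L.entry (eL.revSimplex j.1) ≤ t ∧
      ∀ h : ρ.R.col j.1 ≠ 0, t < K.entry (eK.revSimplex (piv _ h)) := by
  rw [finiteBar, pivSimp_V_col]
  exact and_congr_right fun _ => ⟨fun h _ => h, fun h => h j.2⟩

theorem mem_infiniteBar_iff (i : Fin n) (t : Fin (N + 1)) :
    t ∈ (infiniteBar eL ρ i).1 ↔ L.entry (eL.revSimplex i) ≤ t := by
  rw [infiniteBar, pivSimp_V_col]
  exact Iff.rfl

end Reduction

end Bars

theorem mainTheorem1 {𝔽 : Type v} [Field 𝔽] {U V : Type u} [LinearOrder U] [LinearOrder V]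
    {N n : ℕ} (L : SimplicialFiltration U N) (K : SimplicialFiltration V N)
    (f : FiltrationMono L K) (eL : SimplexOrder L n) (eK : SimplexOrder K n) :
    -- the coboundary matrix of `L` can be reduced with clearing: no run of the procedure gets
    -- stuck, and the outcome of every complete run is a reduction
    ((∀ (d : ℕ) (X : Matrix (Fin n) (Fin n) 𝔽),
        ClearingRun eL.revDim (antiTranspose (eL.boundaryMatrix 𝔽)) d X →
          ∃ Y, ClearingRun eL.revDim (antiTranspose (eL.boundaryMatrix 𝔽)) (d + 1) Y ∧
            ColumnOps {j | eL.revDim j = d ∧ j ∉ clearedIn eL.revDim d X}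
              (clearColumns (clearedIn eL.revDim d X) X) Y) ∧
      (∀ (d : ℕ) (X : Matrix (Fin n) (Fin n) 𝔽), (∀ j, eL.revDim j < d) →
        ClearingRun eL.revDim (antiTranspose (eL.boundaryMatrix 𝔽)) d X →
          ∃ R : Reduction (antiTranspose (eL.boundaryMatrix 𝔽)), R.R = X)) ∧
    -- the mixed coboundary matrix can be reduced with clearing: given a reduction `R` of the
    -- coboundary matrix of `L`, the columns `j` with `r_j = 0` may be set to zero, no further
    -- column becomes zero, and reducing the remaining columns gives a reduction
    (∀ R : Reduction (antiTranspose (eL.boundaryMatrix 𝔽)),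
      (∃ X, ColumnOps {j | R.R.col j ≠ 0} (clearColumns {j | R.R.col j = 0}
          (antiTranspose (f.mixedMatrix 𝔽 eL eK))) X ∧ IsColReduced X) ∧
      (∀ X, ColumnOps {j | R.R.col j ≠ 0} (clearColumns {j | R.R.col j = 0}
          (antiTranspose (f.mixedMatrix 𝔽 eL eK))) X →
        (∀ j, X.col j = 0 ↔ R.R.col j = 0) ∧
        (IsColReduced X →
          ∃ S : Reduction (antiTranspose (f.mixedMatrix 𝔽 eL eK)), S.R = X))) ∧
    -- any reductions of the two matrices determine the image barcode
    (∀ (S : Reduction (antiTranspose (f.mixedMatrix 𝔽 eL eK)))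
      (R : Reduction (antiTranspose (eL.boundaryMatrix 𝔽))),
      (PersMod.image (f.totalHomologyMap 𝔽)).HasBarcode
        (Sum.elim
          (fun j : {j : {j : Fin n // S.R.col j ≠ 0} //
              (finiteBar eL eK S j).1.Nonempty} => finiteBar eL eK S j.1)
          (fun i : {i : Fin n // R.R.col i = 0 ∧ i ∉ pivs R.R} => infiniteBar eL R i.1)) ∧
      ∀ d : ℕ, (PersMod.image (f.homologyMap 𝔽 d)).HasBarcode
        (Sum.elim
          (fun j : {j : {j : Fin n // S.R.col j ≠ 0} //
              (finiteBar eL eK S j).1.Nonempty ∧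
                (eL.pivSimp (S.V.col j.1) (S.V_col_ne_zero j.1)).1.card = d + 1} =>
            finiteBar eL eK S j.1)
          (fun i : {i : Fin n // (R.R.col i = 0 ∧ i ∉ pivs R.R) ∧
              (eL.pivSimp (R.V.col i) (R.V_col_ne_zero i)).1.card = d + 1} =>
            infiniteBar eL R i.1))) := by
  refine ⟨⟨fun d X h => h.exists_step, fun d X hd h => h.exists_reduction
    eL.antiTranspose_boundaryMatrix_mul_self
    (fun i j hij => eL.revDim_of_boundaryMatrix_ne_zero hij) hd⟩, fun R => ?_, fun S R => ?_⟩
  · rw [f.antiTranspose_mixedMatrix eL eK]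
    exact R.clearColumns_mul (f.isUnit_antiTranspose_chainMatrix_inv eL eK)
  · classical
    refine ⟨PersMod.HasBarcode.image_directSumMap (f.homologyMap 𝔽)
      (fun a => eL.revDim (Sum.elim (fun j => j.1.1) (fun i => i.1) a)) _ fun d => ?_, fun d => ?_⟩
    · refine f.hasBarcode_image_homologyMap S R d
        (fun a => Sum.elim (fun j => j.1.1) (fun i => i.1) a.1) ?_ _ ?_ ?_ ?_
      · rintro ⟨⟨j, hj⟩ | ⟨i, hi⟩, _⟩ ⟨⟨j', hj'⟩ | ⟨i', hi'⟩, _⟩ h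
        · exact Subtype.ext (congrArg Sum.inl (Subtype.ext (Subtype.ext h)))
        · obtain rfl : j.1 = i' := h
          exact absurd ((f.col_eq_zero_iff S R _).2 hi'.1) j.2
        · obtain rfl : i = j'.1 := h
          exact absurd ((f.col_eq_zero_iff S R _).2 hi.1) j'.2
        · exact Subtype.ext (congrArg Sum.inr (Subtype.ext h))
      · rintro ⟨⟨j, hj⟩ | ⟨i, hi⟩, hd⟩
        · exact ⟨f.notMem_pivs_of_col_ne_zero S R _ j.2, hd⟩
        · exact ⟨hi.2, hd⟩
      · rintro ⟨⟨j, hj⟩ | ⟨i, hi⟩, _⟩ t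
        · exact S.mem_finiteBar_iff j t
        · exact (R.mem_infiniteBar_iff i t).trans
            (and_iff_left fun h => absurd ((f.col_eq_zero_iff S R i).2 hi.1) h).symm
      · intro c hc hd t ht h
        by_cases hS : S.R.col c = 0
        · exact ⟨⟨Sum.inr ⟨c, (f.col_eq_zero_iff S R c).1 hS, hc⟩, hd⟩, rfl⟩
        · exact ⟨⟨Sum.inl ⟨⟨c, hS⟩, t, (S.mem_finiteBar_iff ⟨c, hS⟩ t).2 ⟨ht, fun _ => h hS⟩⟩, hd⟩,
            rfl⟩
    · refine f.hasBarcode_image_homologyMap S R d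
        (Sum.elim (fun j => j.1.1) (fun i => i.1)) ?_ _ ?_ ?_ ?_
      · rintro (⟨j, hj⟩ | ⟨i, hi⟩) (⟨j', hj'⟩ | ⟨i', hi'⟩) h
        · exact congrArg Sum.inl (Subtype.ext (Subtype.ext h))
        · obtain rfl : j.1 = i' := h
          exact absurd ((f.col_eq_zero_iff S R _).2 hi'.1.1) j.2
        · obtain rfl : i = j'.1 := h
          exact absurd ((f.col_eq_zero_iff S R _).2 hi.1.1) j'.2
        · exact congrArg Sum.inr (Subtype.ext h)
      · rintro (⟨j, hj⟩ | ⟨i, hi⟩)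
        · exact ⟨f.notMem_pivs_of_col_ne_zero S R _ j.2, (S.card_pivSimp_V_col_iff j.1 d).1 hj.2⟩
        · exact ⟨hi.1.2, (R.card_pivSimp_V_col_iff i d).1 hi.2⟩
      · rintro (⟨j, hj⟩ | ⟨i, hi⟩) t
        · exact S.mem_finiteBar_iff j t
        · exact (R.mem_infiniteBar_iff i t).trans
            (and_iff_left fun h => absurd ((f.col_eq_zero_iff S R i).2 hi.1.1) h).symm
      · intro c hc hd t ht h
        by_cases hS : S.R.col c = 0
        · exact ⟨Sum.inr ⟨c, ⟨(f.col_eq_zero_iff S R c).1 hS, hc⟩,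
            (R.card_pivSimp_V_col_iff c d).2 hd⟩, rfl⟩
        · exact ⟨Sum.inl ⟨⟨c, hS⟩, ⟨t, (S.mem_finiteBar_iff ⟨c, hS⟩ t).2 ⟨ht, fun _ => h hS⟩⟩,
            (S.card_pivSimp_V_col_iff c d).2 hd⟩, rfl⟩
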